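/- Let $\mathbf X=(X,d,\alpha)$ be a constructive metric space: $(X,d)$ is a complete metric space, $\alpha:\mathbb N\to X$ enumerates a dense set, and $d(\alpha(m),\alpha(n))$ is computable to any precision from $m,n$. Basic balls of $X$ are the open balls with centre some $\alpha(n)$ and positive rational radius. Let $\mathcal M(X)$ be the space of Borel probability measures on $X$ with the Prokhorov distance; its basic balls are the open balls of positive rational radius around the measures that are concentrated on a finite set of points $\alpha(n)$ and take rational values, in their natural numbering. Basic open sets of $X\times\mathcal M(X)$ are products of basic balls. A function $f$ with values in $[0,\infty]$ is lower semicomputable if the sets $\{f>r\}$, $r\in\mathbb Q$, are unions of recursively enumerable families of basic open sets, uniformly in $r$. A uniform test is a lower semicomputable $u:X\times\mathcal M(X)\to[0,\infty]$ with $\int u(x,P)\,dP(x)\le 1$ for all $P\in\mathcal M(X)$; a point $x$ is uniformly random with respect to $P$ if $u(x,P)<\infty$ for every uniform test $u$ (equivalently, for a universal one). For a class $\mathcal C\subseteq\mathcal M(X)$, a $\mathcal C$-test is a lower semicomputable $u:X\to[0,\infty]$ with $\int u\,dP\le 1$ for all $P\in\mathcal C$. A test of either kind is universal if it is maximal, up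 to a constant factor, among the tests of that kind. The class $\mathcal C$ is effectively compact if it is compact and the set of all finite families of basic balls of $\mathcal M(X)$ covering $\mathcal C$ is recursively enumerable; it is effectively orthogonal if no point is uniformly random with respect to two different measures of $\mathcal C$. A test-separator for $\mathcal C$ is a uniform test $s$ such that for all $P\ne Q$ in $\mathcal C$ and all $x\in X$ at least one of $s(x,P)$, $s(x,Q)$ is infinite. Theorem. Let $\mathcal C$ be an effectively compact, effectively orthogonal class of probability measures on $X$. Let $\mathbf t(x,P)$ be a universal uniform test, $\mathbf t_{\mathcal C}(x)$ a universal $\mathcal C$-test, and $s(x,P)$ a test-separator for $\mathcal C$. Then there is a finite constant $c$ such that for all $P\in\mathcal C$ and all $x\in X$ $$\mathbf t(x,P)\le c\cdot\max(\mathbf t_{\mathcal C}(x),s(x,P))\quad\text{and}\quad \max(\mathbf t_{\mathcal C}(x),s(x,P))\le c\cdot\mathbf t(x,P).$$ -/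

import Mathlib

open MeasureTheory Set
open scoped ENNReal NNReal

/-!
Numbered bases, effectively open sets, lower semicomputable functions.

A numbered base is a family `b : ι → Set X` of basic open sets, indexed by a type `ι` of
constructive objects. The recursively enumerable predicates on `ι` are those of Mathlib.
-/

/-- The non-negative rational number `a / (b + 1)` named by the pair `(a, b)`. -/
noncomputable def ratCode (q : ℕ × ℕ) : ℝ := (q.1 : ℝ) / ((q.2 : ℝ) + 1)

/-- The positive rational number `(a + 1) / (b + 1)` named by the pair `(a, b)`. -/
noncomputable def posRatCode (q : ℕ × ℕ) : ℝ := ((q.1 : ℝ) + 1) / ((q.2 : ℝ) + 1)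

/-- The basic balls of a metric space with a numbered set of points `α i`: all open balls with
center some `α i` and positive rational radius. -/
def basicBall {X ι : Type*} [PseudoMetricSpace X] (α : ι → X) (i : ι × (ℕ × ℕ)) : Set X :=
  Metric.ball (α i.1) (posRatCode i.2)

/-- The basic open sets of a product: products of basic open sets of the factors. -/
def prodBase {X Y ι κ : Type*} (b : ι → Set X) (b' : κ → Set Y) (i : ι × κ) : Set (X × Y) :=
  b i.1 ×ˢ b' i.2

/-- `f : X → [0, ∞]` is lower semicomputable: the sets `{x | f x > r}` are effectively open
(unions of recursively enumerable families of basic open sets), uniformly in the rational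
number `r`. For negative `r` the set is the whole space, so `r` ranges over the non-negative
rational numbers only. -/
def LowerSemicomputable {X ι : Type*} [Primcodable ι] (b : ι → Set X) (f : X → ℝ≥0∞) : Prop :=
  ∃ E : ι × (ℕ × ℕ) → Prop, REPred E ∧
    ∀ q : ℕ × ℕ, {x | ENNReal.ofReal (ratCode q) < f x} = ⋃ i ∈ {i | E (i, q)}, b i

/-- A compact set `C` is effectively compact if one can enumerate all finite families of basic
open sets that cover `C`. -/
def EffectivelyCompact {X ι : Type*} [TopologicalSpace X] [Primcodable ι] (b : ι → Set X)
    (C : Set X) : Prop :=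
  IsCompact C ∧ REPred fun l : List ι => C ⊆ ⋃ i ∈ {i | i ∈ l}, b i

/-- The structure of a constructive metric space: the metric space is complete, `α` enumerates
a dense set of points (so the space is separable), and the distance between `α m` and `α n` is
computable to any precision from `m` and `n`. -/
structure ConstructiveMetricSpace (X : Type*) [MetricSpace X] where
  /-- the numbering of the distinguished points -/
  α : ℕ → X
  complete : CompleteSpace X
  dense : DenseRange α
  computable_dist : ∃ f : ℕ × ℕ × ℕ → ℕ, Computable f ∧
    ∀ m n k : ℕ, |dist (α m) (α n) - (f (m, n, k) : ℝ) / 2 ^ k| ≤ 1 / 2 ^ k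

/-! The space of probability measures. -/

/-- The space `M(X)` of Borel probability measures on `X`, with the Prokhorov distance. -/
abbrev MeasSpace (X : Type*) [MeasurableSpace X] : Type _ := LevyProkhorov (ProbabilityMeasure X)

/-- The underlying measure of a point of `M(X)`. -/
noncomputable def MeasSpace.meas {X : Type*} [MeasurableSpace X] (P : MeasSpace X) : Measure X :=
  (P.toMeasure : Measure X)

/-- The measure named by a non-empty list of pairs `(n, w)`: it is concentrated on the points
`α n`, and each entry `(n, w)` contributes mass proportional to `w + 1` at `α n`. These are all
the probability measures with rational values supported by a finite set of distinguished
points. A non-empty list is given by its head and its tail. -/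
noncomputable def idealMeas {X : Type*} [MeasurableSpace X] (α : ℕ → X)
    (l : (ℕ × ℕ) × List (ℕ × ℕ)) : Measure X :=
  ((l.1 :: l.2).map fun p => ((p.2 + 1 : ℕ) : ℝ≥0∞)).sum⁻¹ •
    ((l.1 :: l.2).map fun p => ((p.2 + 1 : ℕ) : ℝ≥0∞) • Measure.dirac (α p.1)).sum

theorem listMeas_univ {X : Type*} [MeasurableSpace X] (α : ℕ → X) (l : List (ℕ × ℕ)) :
    (l.map fun p => ((p.2 + 1 : ℕ) : ℝ≥0∞) • Measure.dirac (α p.1)).sum univ =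
      (l.map fun p => ((p.2 + 1 : ℕ) : ℝ≥0∞)).sum := by
  induction l with
  | nil => simp
  | cons p l ih =>
    rw [List.map_cons, List.sum_cons, List.map_cons, List.sum_cons, Measure.add_apply, ih,
      Measure.smul_apply, measure_univ, smul_eq_mul, mul_one]

theorem listWeight_ne_top (l : List (ℕ × ℕ)) :
    (l.map fun p => ((p.2 + 1 : ℕ) : ℝ≥0∞)).sum ≠ ∞ := by
  induction l with
  | nil => simp
  | cons p l ih =>
    rw [List.map_cons, List.sum_cons]
    exact ENNReal.add_ne_top.2 ⟨ENNReal.natCast_ne_top _, ih⟩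

instance idealMeas_isProbabilityMeasure {X : Type*} [MeasurableSpace X] (α : ℕ → X)
    (l : (ℕ × ℕ) × List (ℕ × ℕ)) : IsProbabilityMeasure (idealMeas α l) := by
  constructor
  rw [idealMeas, Measure.smul_apply, listMeas_univ, smul_eq_mul]
  refine ENNReal.inv_mul_cancel ?_ (listWeight_ne_top _)
  rw [List.map_cons, List.sum_cons]
  simp

/-- The numbering of the distinguished points of `M(X)`. -/
noncomputable def idealPoint {X : Type*} [MeasurableSpace X] (α : ℕ → X)
    (l : (ℕ × ℕ) × List (ℕ × ℕ)) : MeasSpace X :=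
  LevyProkhorov.ofMeasure ⟨idealMeas α l, inferInstance⟩

namespace ConstructiveMetricSpace

variable {X : Type*} [MetricSpace X] [MeasurableSpace X] [BorelSpace X]

/-- The basic balls of `X`. -/
def base (S : ConstructiveMetricSpace X) : ℕ × (ℕ × ℕ) → Set X := basicBall S.α

/-- The basic balls of `M(X)`. -/
def measBase (S : ConstructiveMetricSpace X) :
    ((ℕ × ℕ) × List (ℕ × ℕ)) × (ℕ × ℕ) → Set (MeasSpace X) :=
  basicBall (idealPoint S.α)

/-! Randomness tests. -/

/-- Uniform tests: lower semicomputable functions `t(x, P)` with `∫ t(x, P) dP(x) ≤ 1` for every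
probability measure `P`. -/
def IsUniformTest (S : ConstructiveMetricSpace X) (t : X → MeasSpace X → ℝ≥0∞) : Prop :=
  LowerSemicomputable (prodBase S.base S.measBase) (Function.uncurry t) ∧
    ∀ P : MeasSpace X, ∫⁻ x, t x P ∂P.meas ≤ 1

/-- Universal uniform tests: uniform tests that are maximal up to a constant factor. -/
def IsUniversalUniformTest (S : ConstructiveMetricSpace X) (t : X → MeasSpace X → ℝ≥0∞) : Prop :=
  S.IsUniformTest t ∧ ∀ u, S.IsUniformTest u → ∃ c : ℝ≥0, ∀ x P, u x P ≤ c * t x P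

/-- Tests for a class `C` of measures: lower semicomputable functions `t(x)` with
`∫ t(x) dP(x) ≤ 1` for every `P ∈ C`. -/
def IsClassTest (S : ConstructiveMetricSpace X) (C : Set (MeasSpace X)) (t : X → ℝ≥0∞) : Prop :=
  LowerSemicomputable S.base t ∧ ∀ P ∈ C, ∫⁻ x, t x ∂P.meas ≤ 1

/-- Universal tests for the class `C`: tests for `C` that are maximal up to a constant factor. -/
def IsUniversalClassTest (S : ConstructiveMetricSpace X) (C : Set (MeasSpace X))
    (t : X → ℝ≥0∞) : Prop :=
  S.IsClassTest C t ∧ ∀ u, S.IsClassTest C u → ∃ c : ℝ≥0, ∀ x, u x ≤ c * t x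

/-- A point is uniformly random with respect to `P` if it passes every uniform test,
equivalently, if a universal uniform test is finite at `(x, P)`. -/
def randoms (S : ConstructiveMetricSpace X) (P : MeasSpace X) : Set X :=
  {x | ∀ t, S.IsUniformTest t → t x P < ∞}

/-- A class of measures is effectively orthogonal if no point is uniformly random with respect to
two different measures of the class. -/
def EffectivelyOrthogonal (S : ConstructiveMetricSpace X) (C : Set (MeasSpace X)) : Prop :=
  ∀ P ∈ C, ∀ Q ∈ C, P ≠ Q → S.randoms P ∩ S.randoms Q = ∅

end ConstructiveMetricSpace

/-- Separators for a class `C`: Borel measurable functions `s(x, P)` such that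
`∫ s(x, P) dP(x) ≤ 1` for every probability measure `P`, and for different `P, Q ∈ C` and every
point `x` at least one of `s(x, P)`, `s(x, Q)` is infinite. -/
structure IsSeparator {X : Type*} [MetricSpace X] [MeasurableSpace X] [BorelSpace X]
    (C : Set (MeasSpace X)) (s : X → MeasSpace X → ℝ≥0∞) : Prop where
  measurable : Measurable[borel (X × MeasSpace X)] (Function.uncurry s)
  lintegral_le : ∀ P : MeasSpace X, ∫⁻ x, s x P ∂P.meas ≤ 1
  separates : ∀ P ∈ C, ∀ Q ∈ C, P ≠ Q → ∀ x, s x P = ∞ ∨ s x Q = ∞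

/-- Test-separators: separators that are lower semicomputable as functions of `x` and `P`. -/
def ConstructiveMetricSpace.IsTestSeparator {X : Type*} [MetricSpace X] [MeasurableSpace X]
    [BorelSpace X] (S : ConstructiveMetricSpace X) (C : Set (MeasSpace X))
    (s : X → MeasSpace X → ℝ≥0∞) : Prop :=
  IsSeparator C s ∧ LowerSemicomputable (prodBase S.base S.measBase) (Function.uncurry s)

/-! Upper bound for `t`: let `s x P` be finite. Then `s x Q = ∞` for every other `Q ∈ C`. As `s` is
itself a uniform test, universality gives `t x Q = ∞`, so `P` minimises `t x` over `C`. By effective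
compactness the infimum of `t x` over `C` is a class test (`IsUniformTest.isClassTest_iInf`), hence
at most a constant times `tC x`. If `s x P = ∞` the bound is trivial.

Lower bound for `t`: `s` is dominated by universality, and it remains to dominate `tC` on `C` by a
uniform test (`IsClassTest.exists_isUniformTest`). A class test is approximated by integer-valued
layers, each built from finitely many balls, and a layer is admitted at `P` only if its integral is
certified to be below `3`. The certificate uses closed balls, whose layers are upper semicontinuous,
so it persists near `P` and can be checked at finitely supported measures. The supremum uses open
balls, which makes it lower semicomputable. Measures of `C` pass all certificates, so on `C` nothing
is lost but the factor `3`. -/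

section Computability

/-! ### Computable list operations and recursively enumerable predicates. -/

variable {A B D : Type*} [Primcodable A] [Primcodable B] [Primcodable D]

/-- A fold is a primitive recursion on the index. Leaving the accumulator unchanged at a missing
entry makes stage `n` the fold over `take n`. -/
theorem Computable.list_foldl {f : A → List B} {g : A → D} {h : A → D → B → D}
    (hf : Computable f) (hg : Computable g)
    (hh : Computable fun p : A × D × B => h p.1 p.2.1 p.2.2) :
    Computable fun a => (f a).foldl (h a) (g a) := by
  have key : ∀ (a : A) (n : ℕ),
      (Nat.rec (g a) (fun m acc => ((f a)[m]?).elim acc fun b => h a acc b) n : D) =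
        ((f a).take n).foldl (h a) (g a) := by
    intro a n
    induction n with
    | zero => simp
    | succ n ih =>
      simp only [ih]
      rw [List.take_add_one, List.foldl_append]
      cases (f a)[n]? <;> simp
  have hstep : Computable₂ fun (a : A) (p : ℕ × D) =>
      ((f a)[p.1]?).elim p.2 fun b => h a p.2 b := by
    have h1 : Computable fun q : A × ℕ × D => (f q.1)[q.2.1]? :=
      Computable.list_getElem?.comp (hf.comp .fst) (Computable.fst.comp .snd)
    have h2 : Computable₂ fun (q : A × ℕ × D) (b : B) => h q.1 q.2.2 b :=
      hh.comp (Computable.pair (Computable.fst.comp .fst)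
        (Computable.pair (Computable.snd.comp (Computable.snd.comp .fst)) .snd))
    refine (Computable.option_casesOn h1 (Computable.snd.comp .snd) h2).of_eq fun q => ?_
    simp only []
    cases (f q.1)[q.2.1]? <;> rfl
  refine (Computable.nat_rec (Computable.list_length.comp hf) hg hstep).of_eq fun a => ?_
  rw [key a, List.take_length]

theorem Computable.list_all {f : A → List B} {h : A → B → Bool}
    (hf : Computable f) (hh : Computable₂ h) : Computable fun a => (f a).all (h a) := by
  have hstep : Computable fun p : A × Bool × B => p.2.1 && h p.1 p.2.2 :=
    (Primrec.and.to_comp (α := Bool)).comp (Computable.fst.comp .snd)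
      (hh.comp .fst (Computable.snd.comp .snd))
  refine (Computable.list_foldl hf (.const true) (h := fun a acc b => acc && h a b)
    hstep).of_eq fun a => ?_
  have : ∀ (l : List B) (c : Bool), l.foldl (fun acc b => acc && h a b) c = (c && l.all (h a)) := by
    intro l
    induction l with
    | nil => simp
    | cons b l ih => intro c; simp [ih, Bool.and_assoc]
  simp [this]

theorem Computable.list_sum {f : A → List B} {h : A → B → ℕ}
    (hf : Computable f) (hh : Computable₂ h) : Computable fun a => ((f a).map (h a)).sum := by
  have hstep : Computable fun p : A × ℕ × B => p.2.1 + h p.1 p.2.2 :=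
    (Primrec.nat_add.to_comp).comp (Computable.fst.comp .snd)
      (hh.comp .fst (Computable.snd.comp .snd))
  refine (Computable.list_foldl hf (.const 0) (h := fun a acc b => acc + h a b)
    hstep).of_eq fun a => ?_
  have : ∀ (l : List B) (c : ℕ), l.foldl (fun acc b => acc + h a b) c = c + (l.map (h a)).sum := by
    intro l
    induction l with
    | nil => simp
    | cons b l ih => intro c; simp [ih, Nat.add_assoc]
  simp [this]

theorem Computable.finset_sup_range {f : A → ℕ} {h : A → ℕ → ℕ}
    (hf : Computable f) (hh : Computable₂ h) :
    Computable fun a => (Finset.range (f a)).sup (h a) := by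
  have hstep : Computable₂ fun (a : A) (p : ℕ × ℕ) => max (h a p.1) p.2 :=
    (Primrec.nat_max.to_comp).comp (hh.comp .fst (Computable.fst.comp .snd))
      (Computable.snd.comp .snd)
  refine (Computable.nat_rec hf (.const 0) hstep).of_eq fun a => ?_
  generalize f a = n
  induction n with
  | zero => simp
  | succ n ih => simp only [ih]; rw [Finset.range_add_one, Finset.sup_insert]

theorem Computable.nat_pow : Computable₂ ((· ^ ·) : ℕ → ℕ → ℕ) := by
  have hstep : Computable₂ fun (a : ℕ × ℕ) (p : ℕ × ℕ) => p.2 * a.1 :=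
    (Primrec.nat_mul.to_comp).comp (Computable.snd.comp .snd) (Computable.fst.comp .fst)
  refine (Computable.nat_rec (f := fun a : ℕ × ℕ => a.2) .snd (.const 1) hstep).of_eq fun a => ?_
  obtain ⟨a, n⟩ := a
  simp only
  induction n with
  | zero => simp
  | succ n ih => simp only [ih, pow_succ]

theorem Computable.nat_le_dec {f g : A → ℕ} (hf : Computable f) (hg : Computable g) :
    Computable fun a => decide (f a ≤ g a) :=
  Primrec.nat_le.decide.to_comp.comp hf hg

theorem Computable.nat_lt_dec {f g : A → ℕ} (hf : Computable f) (hg : Computable g) :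
    Computable fun a => decide (f a < g a) :=
  Primrec.nat_lt.decide.to_comp.comp hf hg

theorem Computable.eq_dec [DecidableEq B] {f g : A → B} (hf : Computable f) (hg : Computable g) :
    Computable fun a => decide (f a = g a) :=
  Primrec.eq.decide.to_comp.comp hf hg

theorem Computable.bool_and {f g : A → Bool} (hf : Computable f) (hg : Computable g) :
    Computable fun a => f a && g a := (Primrec.and.to_comp (α := Bool)).comp hf hg

theorem Computable.add' {f g : A → ℕ} (hf : Computable f) (hg : Computable g) :
    Computable fun a => f a + g a := Primrec.nat_add.to_comp.comp hf hg

theorem Computable.mul' {f g : A → ℕ} (hf : Computable f) (hg : Computable g) :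
    Computable fun a => f a * g a := Primrec.nat_mul.to_comp.comp hf hg

/-- A predicate obtained from a decidable one by an existential number quantifier is r.e. -/
theorem REPred.exists_nat {c : A → ℕ → Bool} (hc : Computable₂ c) :
    REPred fun a => ∃ n, c a n = true := by
  have h : Partrec fun a => Nat.rfind fun n => Part.some (c a n) := Partrec.rfind hc.partrec₂
  have h2 := h.dom_re
  refine h2.of_eq fun a => ?_
  refine (Nat.rfind_dom (p := fun n => Part.some (c a n))).trans ?_
  simp only [Part.mem_some_iff, Part.some_dom, implies_true, and_true, eq_comm (a := true)]

/-- Stages of an r.e. predicate. -/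
theorem REPred.exists_stage {p : A → Prop} (hp : REPred p) :
    ∃ c : A → ℕ → Bool, Computable₂ c ∧ ∀ a, p a ↔ ∃ n, c a n = true := by
  have hp' : Partrec fun a => (Part.assert (p a) fun _ => Part.some ()) := hp
  obtain ⟨c, hc⟩ := Nat.Partrec.Code.exists_code.1 hp'
  -- Stage `n` is the bounded evaluation of a code for the semidecision procedure.
  refine ⟨fun a n => (Nat.Partrec.Code.evaln n c (Encodable.encode a)).isSome, ?_, fun a => ?_⟩
  · have h1 : Computable fun q : A × ℕ => Nat.Partrec.Code.evaln q.2 c (Encodable.encode q.1) :=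
      (Nat.Partrec.Code.primrec_evaln.to_comp).comp
        (Computable.pair (Computable.pair .snd (.const c)) (Computable.encode.comp .fst))
    exact (Primrec.option_isSome.to_comp).comp h1
  · have : p a ↔ (Nat.Partrec.Code.eval c (Encodable.encode a)).Dom := by
      rw [hc]; simp [Part.assert]
    rw [this, Part.dom_iff_mem]
    simp only [Nat.Partrec.Code.evaln_complete, Option.isSome_iff_exists, Option.mem_def]
    exact exists_comm

/-- Every r.e. predicate is enumerated by a computable function. -/
theorem REPred.exists_enum {p : A → Prop} (hp : REPred p) :
    ∃ e : ℕ → Option A, Computable e ∧ ∀ a, p a ↔ ∃ n, e n = some a := by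
  obtain ⟨c, hc, hpc⟩ := hp.exists_stage
  -- Dovetailing: `n` codes a candidate together with a stage, and the candidate is output if that
  -- stage accepts it.
  refine ⟨fun n => (Encodable.decode (α := A × ℕ) n).bind fun q =>
    bif c q.1 q.2 then some q.1 else none, ?_, fun a => ?_⟩
  · refine Computable.option_bind Computable.decode ?_
    exact Computable.cond (hc.comp (Computable.fst.comp .snd) (Computable.snd.comp .snd))
      (Computable.option_some.comp (Computable.fst.comp .snd)) (.const none)
  · rw [hpc]
    constructor
    · rintro ⟨n, hn⟩
      exact ⟨Encodable.encode (a, n), by simp [hn]⟩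
    · rintro ⟨n, hn⟩
      obtain ⟨q, -, hq⟩ := Option.bind_eq_some_iff.1 hn
      cases h : c q.1 q.2 <;> simp [h] at hq
      exact ⟨q.2, hq ▸ h⟩

/-- R.e. predicates are closed under existential quantification over constructive objects and
conjunction with a decidable predicate. -/
theorem REPred.exists_and {c : A → B → Bool} (hc : Computable₂ c) {r : D → Prop} (hr : REPred r)
    {h : A → B → D} (hh : Computable₂ h) : REPred fun a => ∃ b, c a b = true ∧ r (h a b) := by
  obtain ⟨k, hk, hrk⟩ := hr.exists_stage
  have h1 : Computable₂ fun (a : A) (n : ℕ) =>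
      ((Encodable.decode (α := B × ℕ) n).map fun q => c a q.1 && k (h a q.1) q.2).getD false := by
    refine Computable.option_getD (Computable.option_map (Computable.decode.comp .snd) ?_)
      (.const false)
    have ha : Computable fun x : (A × ℕ) × B × ℕ => x.1.1 := Computable.fst.comp .fst
    have hb : Computable fun x : (A × ℕ) × B × ℕ => x.2.1 := Computable.fst.comp .snd
    exact (hc.comp ha hb).bool_and (hk.comp (hh.comp ha hb) (Computable.snd.comp .snd))
  refine (REPred.exists_nat h1).of_eq fun a => ?_
  constructor
  · rintro ⟨n, hn⟩
    cases hd : (Encodable.decode (α := B × ℕ) n) with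
    | none => simp [hd] at hn
    | some q =>
      simp only [hd, Option.map_some, Option.getD_some, Bool.and_eq_true] at hn
      exact ⟨q.1, hn.1, (hrk _).2 ⟨_, hn.2⟩⟩
  · rintro ⟨b, hb, hr⟩
    obtain ⟨m, hm⟩ := (hrk _).1 hr
    exact ⟨Encodable.encode (b, m), by simp [hb, hm]⟩

theorem REPred.exists_decide {c : A → B → Bool} (hc : Computable₂ c) :
    REPred fun a => ∃ b, c a b = true := by
  have hr : REPred fun n : ℕ => ∃ m, (fun (_ m : ℕ) => decide (m = m)) n m = true :=
    REPred.exists_nat (Computable.eq_dec .snd .snd)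
  refine (REPred.exists_and hc hr (h := fun _ _ => 0) (Computable.const 0)).of_eq fun a => ?_
  simp

end Computability

/-! ### Integrals under small Prokhorov distance, and density of the ideal measures. -/

section ProkhorovLemmas

/-- The layer-cake formula: it reduces comparing integrals to comparing measures of superlevel sets.
-/
theorem natCast_eq_sum_indicator {Y : Type*} {f : Y → ℕ} {M : ℕ} (x : Y) (hM : f x ≤ M) :
    (f x : ℝ≥0∞) = ∑ s ∈ Finset.range M, {y | s < f y}.indicator (fun _ => (1 : ℝ≥0∞)) x := by
  have : (Finset.range M).filter (fun s => s < f x) = Finset.range (f x) := by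
    ext s; simp only [Finset.mem_filter, Finset.mem_range]; omega
  simp [Set.indicator_apply, this]

theorem sum_indicator_le_natCast {Y : Type*} (f : Y → ℕ) (M : ℕ) (x : Y) :
    ∑ s ∈ Finset.range M, {y | s < f y}.indicator (fun _ => (1 : ℝ≥0∞)) x ≤ f x := by
  have : (Finset.range M).filter (fun s => s < f x) ⊆ Finset.range (f x) := by
    intro s; simp only [Finset.mem_filter, Finset.mem_range]; omega
  have h := Finset.card_le_card this
  rw [Finset.card_range] at h
  simpa [Set.indicator_apply, ← Finset.sum_filter] using h

variable {X : Type*} [MetricSpace X] [MeasurableSpace X] [BorelSpace X]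

instance (P : MeasSpace X) : IsProbabilityMeasure P.meas := by
  unfold MeasSpace.meas; infer_instance

theorem MeasSpace.meas_le_of_dist_lt {P Q : MeasSpace X} {ε : ℝ} (h : dist P Q < ε) {B : Set X}
    (hB : MeasurableSet B) :
    P.meas B ≤ Q.meas (Metric.thickening ε B) + ENNReal.ofReal ε := by
  have h0 : 0 ≤ ε := dist_nonneg.trans h.le
  have h1 : levyProkhorovEDist P.meas Q.meas < ENNReal.ofReal ε := by
    rw [LevyProkhorov.dist_probabilityMeasure_def] at h
    exact (ENNReal.lt_ofReal_iff_toReal_lt (levyProkhorovEDist_ne_top _ _)).2 h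
  have := left_measure_le_of_levyProkhorovEDist_lt h1 hB
  rwa [ENNReal.toReal_ofReal h0] at this

/-- Integrals of bounded functions with natural values on measures at small Prokhorov distance. -/
theorem MeasSpace.lintegral_le_of_dist_lt {P Q : MeasSpace X} {ε : ℝ} (h : dist P Q < ε)
    {f g : X → ℕ} {M : ℕ} (hM : ∀ x, f x ≤ M) (hf : ∀ s, MeasurableSet {x | s < f x})
    (hg : ∀ s, MeasurableSet {x | s < g x}) (hfg : ∀ x y, dist x y < ε → f y ≤ g x) :
    ∫⁻ x, f x ∂P.meas ≤ ∫⁻ x, g x ∂Q.meas + M * ENNReal.ofReal ε := by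
  have h1 : ∫⁻ x, f x ∂P.meas = ∑ s ∈ Finset.range M, P.meas {x | s < f x} := by
    rw [lintegral_congr fun x => natCast_eq_sum_indicator x (hM x), lintegral_finsetSum]
    · exact Finset.sum_congr rfl fun s _ => by rw [lintegral_indicator_const (hf s), one_mul]
    · exact fun s _ => measurable_const.indicator (hf s)
  have h2 : ∑ s ∈ Finset.range M, Q.meas {x | s < g x} ≤ ∫⁻ x, g x ∂Q.meas := by
    refine le_trans (le_of_eq ?_) (lintegral_mono fun x => sum_indicator_le_natCast g M x)
    rw [lintegral_finsetSum]
    · exact Finset.sum_congr rfl fun s _ => by rw [lintegral_indicator_const (hg s), one_mul]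
    · exact fun s _ => measurable_const.indicator (hg s)
  rw [h1]
  refine le_trans ?_ (add_le_add_left h2 _)
  -- By `hfg` the thickened superlevel set of `f` lies in that of `g`, so each of the `M` layers
  -- costs at most `ε`.
  calc ∑ s ∈ Finset.range M, P.meas {x | s < f x}
      ≤ ∑ s ∈ Finset.range M, (Q.meas {x | s < g x} + ENNReal.ofReal ε) := by
        refine Finset.sum_le_sum fun s _ => (meas_le_of_dist_lt h (hf s)).trans ?_
        gcongr
        intro x hx
        obtain ⟨y, hy, hxy⟩ := Metric.mem_thickening_iff.1 hx
        exact lt_of_lt_of_le hy (hfg x y hxy)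
    _ = _ := by simp [Finset.sum_add_distrib]

theorem lintegral_listMeas (α : ℕ → X) (l : List (ℕ × ℕ)) (f : X → ℝ≥0∞) :
    ∫⁻ x, f x ∂(l.map fun p => ((p.2 + 1 : ℕ) : ℝ≥0∞) • Measure.dirac (α p.1)).sum =
      (l.map fun p => ((p.2 + 1 : ℕ) : ℝ≥0∞) * f (α p.1)).sum := by
  induction l with
  | nil => simp
  | cons p l ih =>
    simp only [List.map_cons, List.sum_cons, lintegral_add_measure, lintegral_smul_measure,
      lintegral_dirac, smul_eq_mul, ih]

theorem lintegral_idealMeas (α : ℕ → X) (l : (ℕ × ℕ) × List (ℕ × ℕ)) (f : X → ℝ≥0∞) :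
    ∫⁻ x, f x ∂(idealMeas α l) =
      ((l.1 :: l.2).map fun p => ((p.2 + 1 : ℕ) : ℝ≥0∞)).sum⁻¹ *
        ((l.1 :: l.2).map fun p => ((p.2 + 1 : ℕ) : ℝ≥0∞) * f (α p.1)).sum := by
  rw [idealMeas, lintegral_smul_measure, lintegral_listMeas, smul_eq_mul]

theorem lintegral_natCast_idealMeas (α : ℕ → X) (l : (ℕ × ℕ) × List (ℕ × ℕ)) (f : X → ℕ) :
    ∫⁻ x, f x ∂(idealMeas α l) =
      ((((l.1 :: l.2).map fun p => (p.2 + 1) * f (α p.1)).sum : ℕ) : ℝ≥0∞) /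
        ((((l.1 :: l.2).map fun p => p.2 + 1).sum : ℕ) : ℝ≥0∞) := by
  rw [lintegral_idealMeas, mul_comm, ← div_eq_mul_inv]
  have h : ∀ (k : ℕ × ℕ → ℕ) (l : List (ℕ × ℕ)),
      (((l.map k).sum : ℕ) : ℝ≥0∞) = (l.map fun p => (k p : ℝ≥0∞)).sum := by
    intro k l
    induction l with
    | nil => simp
    | cons p l ih => simp only [List.map_cons, List.sum_cons, Nat.cast_add, ih]
  rw [h, h]
  simp only [Nat.cast_mul]

/-- The space is cut into disjoint pieces `A n` inside small balls around `α n`. Finitely many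
pieces carry almost all the mass; the mass of each is moved to its `α n` and rounded to an integer
weight over a large denominator. Discarded mass and rounding each contribute at most `η / 2`. -/
theorem exists_idealPoint_dist_lt {α : ℕ → X} (hα : DenseRange α) (P : MeasSpace X) {δ : ℝ}
    (hδ : 0 < δ) : ∃ l, dist P (idealPoint α l) < δ := by
  set η := δ / 2 with hη
  have hη0 : 0 < η := by positivity
  set A : ℕ → Set X := disjointed fun n => Metric.ball (α n) η with hA
  have hAm : ∀ n, MeasurableSet (A n) := fun n =>
    MeasurableSet.disjointed (fun n => Metric.isOpen_ball.measurableSet) n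
  have hAd : Pairwise (Function.onFun Disjoint A) := disjoint_disjointed _
  have hAb : ∀ n, A n ⊆ Metric.ball (α n) η := fun n => disjointed_subset _ n
  have hAu : ⋃ n, A n = univ := by
    rw [hA, iUnion_disjointed]
    refine eq_univ_of_forall fun x => ?_
    obtain ⟨n, hn⟩ := hα.exists_dist_lt x hη0
    exact mem_iUnion.2 ⟨n, hn⟩
  set μ := P.meas with hμ
  have hsum : ∑' n, μ (A n) = 1 := by
    rw [← measure_iUnion hAd hAm, hAu, measure_univ]
  have htend := ENNReal.tendsto_nat_tsum fun n => μ (A n)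
  rw [hsum] at htend
  have hlt : 1 - ENNReal.ofReal (η / 2) < 1 :=
    ENNReal.sub_lt_self (by simp) (by simp) (by simp; positivity)
  obtain ⟨N, hN, hN1⟩ :=
    ((htend.eventually (lt_mem_nhds hlt)).and (Filter.eventually_ge_atTop 1)).exists
  obtain ⟨K, rfl⟩ : ∃ K, N = K + 1 := ⟨N - 1, by omega⟩
  -- Rounding raises the total weight to at most `D + N`, so `N ≤ D * (η / 2)` keeps the relative
  -- error small.
  obtain ⟨D, hD⟩ := exists_nat_gt (((K + 1 : ℕ) : ℝ) / (η / 2))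
  have hNpos : (0 : ℝ) < ((K + 1 : ℕ) : ℝ) := by positivity
  have hD0 : (0 : ℝ) < D := lt_trans (by positivity) hD
  have hND : ((K + 1 : ℕ) : ℝ) ≤ D * (η / 2) := by
    rw [div_lt_iff₀ (by positivity)] at hD; exact hD.le
  set N := K + 1
  set p : ℕ → ℝ := fun n => μ.real (A n) with hp
  have hp0 : ∀ n, 0 ≤ p n := fun n => measureReal_nonneg
  have hpsum : ∀ s : Finset ℕ, ∑ n ∈ s, p n ≤ 1 := by
    intro s
    rw [hp, ← measureReal_biUnion_finset (fun i _ j _ hij => hAd hij) (fun n _ => hAm n)]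
    exact measureReal_le_one
  have hpN : 1 - η / 2 ≤ ∑ n ∈ Finset.range N, p n := by
    have h1 := ENNReal.toReal_mono (by simp) (tsub_le_iff_right.1 hN.le)
    rw [ENNReal.toReal_add (by simp) (by simp), ENNReal.toReal_ofReal (by positivity),
      ENNReal.toReal_sum (by simp)] at h1
    simp only [ENNReal.toReal_one] at h1
    have : ∑ n ∈ Finset.range N, p n = ∑ a ∈ Finset.range N, (μ (A a)).toReal := rfl
    linarith
  set w : ℕ → ℕ := fun n => ⌊D * p n⌋₊ with hw
  have hwle : ∀ n, (w n : ℝ) ≤ D * p n := fun n => Nat.floor_le (by have := hp0 n; positivity)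
  have hwlt : ∀ n, D * p n < w n + 1 := fun n => Nat.lt_floor_add_one _
  set l : (ℕ × ℕ) × List (ℕ × ℕ) :=
    ((0, w 0), (List.range K).map fun n => (n + 1, w (n + 1))) with hl
  have hll : l.1 :: l.2 = (List.range N).map fun n => (n, w n) := by
    simp [hl, N, List.range_succ_eq_map, Function.comp_def]
  have hlsum : ∀ k : ℕ × ℕ → ℝ≥0∞,
      ((l.1 :: l.2).map k).sum = ∑ n ∈ Finset.range N, k (n, w n) := by
    intro k
    rw [hll, List.map_map]
    generalize N = m
    induction m with
    | zero => simp
    | succ m ih => simp [List.range_succ, Finset.sum_range_succ, ih]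
  have hwr : ∀ n, ((w n : ℝ≥0∞) + 1).toReal = w n + 1 := fun n => by
    exact_mod_cast ENNReal.toReal_natCast (w n + 1)
  set W : ℝ := ∑ n ∈ Finset.range N, ((w n : ℝ) + 1) with hW
  have hWle : W ≤ D + N := by
    rw [hW, Finset.sum_add_distrib]
    have : ∑ n ∈ Finset.range N, (w n : ℝ) ≤ D := by
      calc _ ≤ ∑ n ∈ Finset.range N, D * p n := Finset.sum_le_sum fun n _ => hwle n
        _ = D * ∑ n ∈ Finset.range N, p n := by rw [Finset.mul_sum]
        _ ≤ D * 1 := by gcongr; exact hpsum _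
        _ = D := mul_one _
    simpa using this
  have hW0 : 0 < W := Finset.sum_pos (fun n _ => by positivity) ⟨0, by simp [N]⟩
  refine ⟨l, lt_of_le_of_lt (b := η) ?_ (by linarith)⟩
  rw [LevyProkhorov.dist_probabilityMeasure_def]
  refine levyProkhorovDist_le_of_forall_le _ _ hη0.le fun ε B hε hB => ?_
  change μ B ≤ idealMeas α l (Metric.thickening ε B) + ENNReal.ofReal ε
  set T := Metric.thickening ε B
  have hT : MeasurableSet T := Metric.isOpen_thickening.measurableSet
  classical
  set s := (Finset.range N).filter fun n => α n ∈ T with hs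
  have hQ : (idealMeas α l).real T = (∑ n ∈ s, ((w n : ℝ) + 1)) / W := by
    have h1 : idealMeas α l T = ∫⁻ x, T.indicator 1 x ∂(idealMeas α l) := by
      rw [lintegral_indicator_one hT]
    rw [measureReal_def, h1, lintegral_idealMeas, hlsum, hlsum, ENNReal.toReal_mul,
      ENNReal.toReal_inv, ENNReal.toReal_sum (by simp), ENNReal.toReal_sum, mul_comm,
      ← div_eq_mul_inv]
    · congr 1
      · rw [hs, Finset.sum_filter]
        refine Finset.sum_congr rfl fun n _ => ?_
        by_cases hn : α n ∈ T <;> simp [hn, hwr]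
      · simp [hW, hwr]
    · intro n _
      by_cases hn : α n ∈ T <;> simp [hn]
  have hBle : μ.real B ≤ ∑ n ∈ s, p n + η / 2 := by
    have hsub : B ⊆ (⋃ n ∈ s, A n) ∪ (⋃ n ∈ Finset.range N, A n)ᶜ := by
      intro x hx
      by_cases hxN : x ∈ ⋃ n ∈ Finset.range N, A n
      · left
        simp only [mem_iUnion] at hxN ⊢
        obtain ⟨n, hn, hxn⟩ := hxN
        refine ⟨n, ?_, hxn⟩
        rw [hs, Finset.mem_filter]
        refine ⟨hn, Metric.mem_thickening_iff.2 ⟨x, hx, ?_⟩⟩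
        have := hAb n hxn
        rw [Metric.mem_ball, dist_comm] at this
        linarith
      · exact Or.inr hxN
    have hUm : MeasurableSet (⋃ n ∈ Finset.range N, A n) :=
      Finset.measurableSet_biUnion _ fun n _ => hAm n
    calc μ.real B ≤ μ.real ((⋃ n ∈ s, A n) ∪ (⋃ n ∈ Finset.range N, A n)ᶜ) :=
          measureReal_mono hsub
      _ ≤ μ.real (⋃ n ∈ s, A n) + μ.real (⋃ n ∈ Finset.range N, A n)ᶜ := measureReal_union_le _ _
      _ = ∑ n ∈ s, p n + (1 - ∑ n ∈ Finset.range N, p n) := by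
          rw [probReal_compl_eq_one_sub hUm,
            measureReal_biUnion_finset (fun i _ j _ hij => hAd hij) (fun n _ => hAm n),
            measureReal_biUnion_finset (fun i _ j _ hij => hAd hij) (fun n _ => hAm n)]
      _ ≤ _ := by linarith
  have hkey : ∑ n ∈ s, p n ≤ (idealMeas α l).real T + η / 2 := by
    rw [hQ, ← sub_le_iff_le_add, le_div_iff₀ hW0]
    have h1 : D * ∑ n ∈ s, p n ≤ ∑ n ∈ s, ((w n : ℝ) + 1) := by
      rw [Finset.mul_sum]; exact Finset.sum_le_sum fun n _ => (hwlt n).le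
    refine le_trans ?_ h1
    have h2 := hpsum s
    have h3 : 0 ≤ ∑ n ∈ s, p n := Finset.sum_nonneg fun n _ => hp0 n
    -- The bound `W ≤ D + N` may be multiplied only by a nonnegative factor.
    by_cases h5 : ∑ n ∈ s, p n - η / 2 ≤ 0
    · exact (mul_nonpos_of_nonpos_of_nonneg h5 hW0.le).trans (by positivity)
    · push Not at h5
      calc (∑ n ∈ s, p n - η / 2) * W ≤ (∑ n ∈ s, p n - η / 2) * (D + N) := by gcongr
        _ ≤ D * ∑ n ∈ s, p n := by nlinarith
  have hfin : μ.real B ≤ (idealMeas α l).real T + ε := by linarith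
  rw [← ofReal_measureReal (μ := μ), ← ofReal_measureReal (μ := idealMeas α l),
    ← ENNReal.ofReal_add measureReal_nonneg (by linarith)]
  exact ENNReal.ofReal_le_ofReal hfin

end ProkhorovLemmas

/-! ### Finite layers of a lower semicomputable function and their computable approximation. -/

section LayerFunctions

theorem posRatCode_pos (q : ℕ × ℕ) : 0 < posRatCode q := by unfold posRatCode; positivity

theorem exists_posRatCode_btwn {d r : ℝ} (hd : 0 ≤ d) (h : d < r) :
    ∃ q, d < posRatCode q ∧ posRatCode q < r := by
  obtain ⟨q, hq1, hq2⟩ := exists_rat_btwn h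
  have hq0 : 0 < q := by exact_mod_cast hd.trans_lt hq1
  have hnum : 0 < q.num := Rat.num_pos.2 hq0
  refine ⟨(q.num.toNat - 1, q.den - 1), ?_⟩
  have : posRatCode (q.num.toNat - 1, q.den - 1) = q := by
    have h1 : ((q.num.toNat - 1 : ℕ) : ℝ) + 1 = q.num := by
      have : ((q.num.toNat - 1 : ℕ) : ℤ) + 1 = q.num := by omega
      exact_mod_cast this
    have h2 : ((q.den - 1 : ℕ) : ℝ) + 1 = q.den := by
      have : (q.den - 1 : ℕ) + 1 = q.den := by have := q.den_pos; omega
      exact_mod_cast this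
    rw [posRatCode, h1, h2]
    exact (Rat.cast_def q).symm
  rw [this]
  exact ⟨hq1, hq2⟩

variable {X : Type*} [MetricSpace X]

/-- The largest value `v + 1` over those of the first `n` entries `((i, r), v)` of `e` for which
the closed ball around `α i` of radius `r + δ` contains `x`. -/
noncomputable def closedLayer (α : ℕ → X) (e : ℕ → Option ((ℕ × ℕ × ℕ) × ℕ)) (n : ℕ) (δ : ℝ)
    (x : X) : ℕ :=
  (Finset.range n).sup fun m => (e m).elim 0 fun b =>
    if dist x (α b.1.1) ≤ posRatCode b.1.2 + δ then b.2 + 1 else 0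

/-- The largest value `v + 1` over those of the first `n` entries `((i, r), v)` of `e` for which
the open ball around `α i` of radius `r` contains `x`. -/
noncomputable def openLayer (α : ℕ → X) (e : ℕ → Option ((ℕ × ℕ × ℕ) × ℕ)) (n : ℕ) (x : X) : ℕ :=
  (Finset.range n).sup fun m => (e m).elim 0 fun b =>
    if dist x (α b.1.1) < posRatCode b.1.2 then b.2 + 1 else 0

/-- The largest value `v + 1` over the first `n` entries `((i, r), v)` of `e`. -/
def layerBound (e : ℕ → Option ((ℕ × ℕ × ℕ) × ℕ)) (n : ℕ) : ℕ :=
  (Finset.range n).sup fun m => (e m).elim 0 fun b => b.2 + 1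

variable (α : ℕ → X) (e : ℕ → Option ((ℕ × ℕ × ℕ) × ℕ))

theorem lt_closedLayer_iff {n : ℕ} {δ : ℝ} {x : X} {s : ℕ} :
    s < closedLayer α e n δ x ↔ ∃ m < n, ∃ b, e m = some b ∧
      dist x (α b.1.1) ≤ posRatCode b.1.2 + δ ∧ s < b.2 + 1 := by
  rw [closedLayer, Finset.lt_sup_iff]
  constructor
  · rintro ⟨m, hm, h⟩
    refine ⟨m, Finset.mem_range.1 hm, ?_⟩
    cases hb : e m with
    | none => simp [hb] at h
    | some b =>
      simp only [hb, Option.elim_some] at h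
      split_ifs at h with h1
      · exact ⟨b, rfl, h1, h⟩
      · omega
  · rintro ⟨m, hm, b, hb, h1, h2⟩
    exact ⟨m, Finset.mem_range.2 hm, by simpa [hb, h1] using h2⟩

theorem lt_openLayer_iff {n : ℕ} {x : X} {s : ℕ} :
    s < openLayer α e n x ↔ ∃ m < n, ∃ b, e m = some b ∧
      dist x (α b.1.1) < posRatCode b.1.2 ∧ s < b.2 + 1 := by
  rw [openLayer, Finset.lt_sup_iff]
  constructor
  · rintro ⟨m, hm, h⟩
    refine ⟨m, Finset.mem_range.1 hm, ?_⟩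
    cases hb : e m with
    | none => simp [hb] at h
    | some b =>
      simp only [hb, Option.elim_some] at h
      split_ifs at h with h1
      · exact ⟨b, rfl, h1, h⟩
      · omega
  · rintro ⟨m, hm, b, hb, h1, h2⟩
    exact ⟨m, Finset.mem_range.2 hm, by simpa [hb, h1] using h2⟩

theorem openLayer_le_closedLayer (n : ℕ) (x : X) :
    openLayer α e n x ≤ closedLayer α e n 0 x := by
  refine le_of_forall_lt fun s hs => ?_
  obtain ⟨m, hm, b, hb, h1, h2⟩ := (lt_openLayer_iff α e).1 hs
  exact (lt_closedLayer_iff α e).2 ⟨m, hm, b, hb, by linarith, h2⟩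

/-- By the triangle inequality, enlarging the radii absorbs a displacement of the point. This
supplies the hypothesis `hfg` of `MeasSpace.lintegral_le_of_dist_lt`. -/
theorem closedLayer_le {n n' : ℕ} (hn : n ≤ n') {δ δ' : ℝ} {x y : X} (h : δ + dist x y ≤ δ') :
    closedLayer α e n δ y ≤ closedLayer α e n' δ' x := by
  refine le_of_forall_lt fun s hs => ?_
  obtain ⟨m, hm, b, hb, h1, h2⟩ := (lt_closedLayer_iff α e).1 hs
  refine (lt_closedLayer_iff α e).2 ⟨m, hm.trans_le hn, b, hb, ?_, h2⟩
  have := dist_triangle x y (α b.1.1)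
  linarith

theorem closedLayer_le_layerBound (n : ℕ) (δ : ℝ) (x : X) :
    closedLayer α e n δ x ≤ layerBound e n := by
  refine le_of_forall_lt fun s hs => ?_
  obtain ⟨m, hm, b, hb, h1, h2⟩ := (lt_closedLayer_iff α e).1 hs
  exact Finset.lt_sup_iff.2 ⟨m, Finset.mem_range.2 hm, by simpa [hb] using h2⟩

theorem measurableSet_lt_closedLayer [MeasurableSpace X] [BorelSpace X] (n : ℕ) (δ : ℝ) (s : ℕ) :
    MeasurableSet {x | s < closedLayer α e n δ x} := by
  have : {x | s < closedLayer α e n δ x} = ⋃ m ∈ {m | m < n}, ⋃ b ∈ {b | e m = some b ∧ s < b.2 + 1},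
      Metric.closedBall (α b.1.1) (posRatCode b.1.2 + δ) := by
    ext x
    simp only [mem_ofPred_eq, lt_closedLayer_iff, mem_iUnion, Metric.mem_closedBall, exists_prop]
    grind
  rw [this]
  exact MeasurableSet.biUnion (to_countable _) fun m _ => MeasurableSet.biUnion (to_countable _)
    fun b _ => Metric.isClosed_closedBall.measurableSet

theorem measurable_closedLayer [MeasurableSpace X] [BorelSpace X] (n : ℕ) (δ : ℝ) :
    Measurable (closedLayer α e n δ) :=
  measurable_of_Ioi fun s => measurableSet_lt_closedLayer α e n δ s

/-- Only finitely many closed balls are involved, and a point outside one of them has a positive gap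
to its radius. -/
theorem eventually_closedLayer_le (n : ℕ) (x : X) (c : ℝ) :
    ∀ᶠ k : ℕ in Filter.atTop, closedLayer α e n (c / (k + 1)) x ≤ closedLayer α e n 0 x := by
  have h : ∀ᶠ k : ℕ in Filter.atTop, ∀ m ∈ Finset.range n, ∀ b, e m = some b →
      dist x (α b.1.1) ≤ posRatCode b.1.2 + c / (k + 1) → dist x (α b.1.1) ≤ posRatCode b.1.2 := by
    rw [Filter.eventually_all_finset]
    intro m _
    cases hb : e m with
    | none => simp
    | some b =>
      simp only [Option.some.injEq, forall_eq']
      by_cases h : dist x (α b.1.1) ≤ posRatCode b.1.2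
      · exact Filter.Eventually.of_forall fun _ _ => h
      · have ht : Filter.Tendsto (fun k : ℕ => posRatCode b.1.2 + c / ((k : ℝ) + 1)) Filter.atTop
            (nhds (posRatCode b.1.2 + 0)) :=
          tendsto_const_nhds.add (tendsto_const_nhds.div_atTop
            (Filter.tendsto_atTop_add_const_right _ _ tendsto_natCast_atTop_atTop))
        rw [add_zero] at ht
        filter_upwards [ht.eventually (gt_mem_nhds (not_le.1 h))] with k hk h'
        exact absurd h' (not_le.2 hk)
  filter_upwards [h] with k hk
  refine le_of_forall_lt fun s hs => ?_
  obtain ⟨m, hm, b, hb, h1, h2⟩ := (lt_closedLayer_iff α e).1 hs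
  exact (lt_closedLayer_iff α e).2 ⟨m, hm, b, hb, by
    rw [add_zero]; exact hk m (Finset.mem_range.2 hm) b hb h1, h2⟩

/-- Layers stabilise pointwise and are bounded by `layerBound`. Hence a strict upper bound on the
integral survives a small enlargement of the radii. -/
theorem tendsto_lintegral_closedLayer [MeasurableSpace X] [BorelSpace X] (μ : Measure X)
    [IsProbabilityMeasure μ] (n : ℕ) {c : ℝ} (hc : 0 ≤ c) :
    Filter.Tendsto (fun k : ℕ => ∫⁻ x, closedLayer α e n (c / (k + 1)) x ∂μ) Filter.atTop
      (nhds (∫⁻ x, closedLayer α e n 0 x ∂μ)) := by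
  have hm : ∀ δ, Measurable fun x => (closedLayer α e n δ x : ℝ≥0∞) := fun δ =>
    (measurable_of_countable (fun k : ℕ => (k : ℝ≥0∞))).comp (measurable_closedLayer α e n δ)
  refine tendsto_lintegral_of_dominated_convergence (fun _ => (layerBound e n : ℝ≥0∞))
    (fun k => hm _) (fun k => Filter.Eventually.of_forall fun x => ?_) (by simp)
    (Filter.Eventually.of_forall fun x => ?_)
  · exact Nat.cast_le.2 (closedLayer_le_layerBound α e n _ x)
  · refine tendsto_const_nhds.congr' ?_
    filter_upwards [eventually_closedLayer_le α e n x c] with k hk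
    have : closedLayer α e n 0 x ≤ closedLayer α e n (c / (k + 1)) x :=
      closedLayer_le α e le_rfl (by rw [dist_self]; simp; positivity)
    rw [le_antisymm hk this]

/-- A decidable approximation, based on the approximate distances `f`, of the statement that
`α j` is at distance at most `r + 1 / (k + 1)` from `α i`, where `(i, r)` names a ball. -/
def nearBall (f : ℕ × ℕ × ℕ → ℕ) (k j : ℕ) (i : ℕ × ℕ × ℕ) : Bool :=
  decide (f (j, i.1, k) * ((i.2.2 + 1) * (k + 1)) ≤
    2 ^ k * ((i.2.1 + 1) * (k + 1) + (i.2.2 + 1)) + (i.2.2 + 1) * (k + 1))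

theorem nearBall_iff {f : ℕ × ℕ × ℕ → ℕ} {k j : ℕ} {i : ℕ × ℕ × ℕ} :
    nearBall f k j i = true ↔
      (f (j, i.1, k) : ℝ) / 2 ^ k ≤ posRatCode i.2 + 1 / (k + 1) + 1 / 2 ^ k := by
  have h1 : (0 : ℝ) < (i.2.2 : ℝ) + 1 := by positivity
  have h2 : (0 : ℝ) < (k : ℝ) + 1 := by positivity
  have h3 : (0 : ℝ) < 2 ^ k := by positivity
  have h4 : posRatCode i.2 + 1 / (k + 1) + 1 / 2 ^ k =
      ((2 ^ k * ((i.2.1 + 1) * (k + 1) + (i.2.2 + 1)) + (i.2.2 + 1) * (k + 1)) /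
        ((i.2.2 + 1) * (k + 1))) / 2 ^ k := by
    unfold posRatCode; field_simp
  rw [h4, div_le_div_iff_of_pos_right h3, le_div_iff₀ (by positivity), nearBall, decide_eq_true_iff]
  exact_mod_cast Iff.rfl

/-- The computable approximation of `closedLayer` at the distinguished points. -/
def approxLayer (f : ℕ × ℕ × ℕ → ℕ) (e : ℕ → Option ((ℕ × ℕ × ℕ) × ℕ)) (n k j : ℕ) : ℕ :=
  (Finset.range n).sup fun m => (e m).elim 0 fun b => bif nearBall f k j b.1 then b.2 + 1 else 0

theorem lt_approxLayer_iff {f : ℕ × ℕ × ℕ → ℕ} {n k j s : ℕ} :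
    s < approxLayer f e n k j ↔ ∃ m < n, ∃ b, e m = some b ∧
      nearBall f k j b.1 = true ∧ s < b.2 + 1 := by
  rw [approxLayer, Finset.lt_sup_iff]
  constructor
  · rintro ⟨m, hm, h⟩
    refine ⟨m, Finset.mem_range.1 hm, ?_⟩
    cases hb : e m with
    | none => simp [hb] at h
    | some b =>
      cases h1 : nearBall f k j b.1 <;> simp [hb, h1] at h
      exact ⟨b, rfl, h1, by omega⟩
  · rintro ⟨m, hm, b, hb, h1, h2⟩
    exact ⟨m, Finset.mem_range.2 hm, by simpa [hb, h1] using h2⟩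

variable {α}

theorem closedLayer_le_approxLayer
    {f : ℕ × ℕ × ℕ → ℕ}
    (hf : ∀ m n k : ℕ, |dist (α m) (α n) - (f (m, n, k) : ℝ) / 2 ^ k| ≤ 1 / 2 ^ k)
    (n k j : ℕ) :
    closedLayer α e n (1 / (k + 1)) (α j) ≤ approxLayer f e n k j := by
  refine le_of_forall_lt fun s hs => ?_
  obtain ⟨m, hm, b, hb, h1, h2⟩ := (lt_closedLayer_iff α e).1 hs
  refine (lt_approxLayer_iff e).2 ⟨m, hm, b, hb, nearBall_iff.2 ?_, h2⟩
  have := abs_le.1 (hf j b.1.1 k)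
  linarith

theorem approxLayer_le_closedLayer
    {f : ℕ × ℕ × ℕ → ℕ}
    (hf : ∀ m n k : ℕ, |dist (α m) (α n) - (f (m, n, k) : ℝ) / 2 ^ k| ≤ 1 / 2 ^ k)
    (n k j : ℕ) :
    approxLayer f e n k j ≤ closedLayer α e n (3 / (k + 1)) (α j) := by
  refine le_of_forall_lt fun s hs => ?_
  obtain ⟨m, hm, b, hb, h1, h2⟩ := (lt_approxLayer_iff e).1 hs
  refine (lt_closedLayer_iff α e).2 ⟨m, hm, b, hb, ?_, h2⟩
  have h3 := abs_le.1 (hf j b.1.1 k)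
  have h4 := nearBall_iff.1 h1
  -- The constant `3`: one unit of slack is built into `nearBall`, and two come from the distance
  -- errors `1 / 2 ^ k`.
  have h5 : (1 : ℝ) / 2 ^ k ≤ 1 / (k + 1) := by
    apply one_div_le_one_div_of_le (by positivity)
    exact_mod_cast Nat.lt_two_pow_self
  have h6 : (3 : ℝ) / (k + 1) = 1 / (k + 1) + 1 / (k + 1) + 1 / (k + 1) := by ring
  linarith

end LayerFunctions

/-! ### Trimming: certified layers, and the integral bound for their supremum. -/

section Trimming

theorem Computable.option_elim {A B D : Type*} [Primcodable A] [Primcodable B] [Primcodable D]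
    {o : A → Option B} {g : A → D} {h : A → B → D} (ho : Computable o) (hg : Computable g)
    (hh : Computable₂ h) : Computable fun a => (o a).elim (g a) (h a) := by
  refine (Computable.option_casesOn ho hg hh).of_eq fun a => ?_
  cases o a <;> rfl

theorem computable_nearBall {f : ℕ × ℕ × ℕ → ℕ} (hf : Computable f) {A : Type*} [Primcodable A]
    {k j : A → ℕ} {i : A → ℕ × ℕ × ℕ} (hk : Computable k) (hj : Computable j) (hi : Computable i) :
    Computable fun a => nearBall f (k a) (j a) (i a) := by
  have hc := Computable.fst.comp hi
  have ha := Computable.succ.comp (Computable.fst.comp (Computable.snd.comp hi))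
  have hb := Computable.succ.comp (Computable.snd.comp (Computable.snd.comp hi))
  have hk1 := Computable.succ.comp hk
  have hp := Computable.nat_pow.comp (.const 2) hk
  exact Computable.nat_le_dec ((hf.comp (hj.pair (hc.pair hk))).mul' (hb.mul' hk1))
    ((hp.mul' ((ha.mul' hk1).add' hb)).add' (hb.mul' hk1))

theorem computable_approxLayer {f : ℕ × ℕ × ℕ → ℕ} (hf : Computable f)
    {e : ℕ → Option ((ℕ × ℕ × ℕ) × ℕ)} (he : Computable e) {A : Type*} [Primcodable A]
    {n k j : A → ℕ} (hn : Computable n) (hk : Computable k) (hj : Computable j) :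
    Computable fun a => approxLayer f e (n a) (k a) (j a) := by
  have hnear : Computable fun q : (A × ℕ) × ((ℕ × ℕ × ℕ) × ℕ) =>
      nearBall f (k q.1.1) (j q.1.1) q.2.1 :=
    computable_nearBall hf (hk.comp (Computable.fst.comp .fst))
      (hj.comp (Computable.fst.comp .fst)) (Computable.fst.comp .snd)
  have hterm : Computable₂ fun (q : A × ℕ) (b : (ℕ × ℕ × ℕ) × ℕ) =>
      bif nearBall f (k q.1) (j q.1) b.1 then b.2 + 1 else 0 :=
    Computable.cond hnear (Computable.succ.comp (Computable.snd.comp .snd)) (.const 0)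
  have helim : Computable₂ fun (a : A) (m : ℕ) => (e m).elim 0 fun b =>
      bif nearBall f (k a) (j a) b.1 then b.2 + 1 else 0 :=
    Computable.option_elim (he.comp .snd) (.const 0) hterm
  exact Computable.finset_sup_range hn helim

theorem computable_layerBound {e : ℕ → Option ((ℕ × ℕ × ℕ) × ℕ)} (he : Computable e) :
    Computable (layerBound e) :=
  Computable.finset_sup_range .id (Computable.option_elim (he.comp .snd) (.const 0)
    (Computable.succ.comp (Computable.snd.comp .snd)))

/-- A decidable sufficient condition for the integral of `closedLayer α e n 0` to be less than `3`
for all measures at distance less than `1 / (k + 1)` from the ideal measure named by `l`. -/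
def smallLayerIntegral (f : ℕ × ℕ × ℕ → ℕ) (e : ℕ → Option ((ℕ × ℕ × ℕ) × ℕ)) (n k : ℕ)
    (l : (ℕ × ℕ) × List (ℕ × ℕ)) : Bool :=
  decide (((l.1 :: l.2).map fun p => (p.2 + 1) * approxLayer f e n k p.1).sum * (k + 1) +
    layerBound e n * ((l.1 :: l.2).map fun p => p.2 + 1).sum <
      3 * (((l.1 :: l.2).map fun p => p.2 + 1).sum * (k + 1)))

theorem computable_smallLayerIntegral {f : ℕ × ℕ × ℕ → ℕ} (hf : Computable f)
    {e : ℕ → Option ((ℕ × ℕ × ℕ) × ℕ)} (he : Computable e) {A : Type*} [Primcodable A]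
    {n k : A → ℕ} {l : A → (ℕ × ℕ) × List (ℕ × ℕ)} (hn : Computable n) (hk : Computable k)
    (hl : Computable l) : Computable fun a => smallLayerIntegral f e (n a) (k a) (l a) := by
  have hll : Computable fun a => (l a).1 :: (l a).2 :=
    Computable.list_cons.comp (Computable.fst.comp hl) (Computable.snd.comp hl)
  have hw : Computable fun q : A × (ℕ × ℕ) => q.2.2 + 1 :=
    Computable.succ.comp (Computable.snd.comp .snd)
  have hW : Computable fun a => (((l a).1 :: (l a).2).map fun p => p.2 + 1).sum :=
    Computable.list_sum hll hw
  have hA : Computable₂ fun (a : A) (p : ℕ × ℕ) => (p.2 + 1) * approxLayer f e (n a) (k a) p.1 :=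
    hw.mul' (computable_approxLayer hf he (hn.comp .fst) (hk.comp .fst) (Computable.fst.comp .snd))
  have hS : Computable fun a => (((l a).1 :: (l a).2).map fun p =>
      (p.2 + 1) * approxLayer f e (n a) (k a) p.1).sum :=
    Computable.list_sum hll hA
  have hk1 : Computable fun a => k a + 1 := Computable.succ.comp hk
  have hM : Computable fun a => layerBound e (n a) := (computable_layerBound he).comp hn
  exact Computable.nat_lt_dec ((hS.mul' hk1).add' (hM.mul' hW))
    ((Computable.const 3).mul' (hW.mul' hk1))

variable {X : Type*} [MetricSpace X]

theorem List.sum_map_mul_le {l : List (ℕ × ℕ)} {g h : ℕ → ℕ} (hgh : ∀ j, g j ≤ h j) :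
    (l.map fun p => (p.2 + 1) * g p.1).sum ≤ (l.map fun p => (p.2 + 1) * h p.1).sum :=
  List.sum_le_sum fun p _ => Nat.mul_le_mul_left _ (hgh p.1)

theorem listWeight_pos (l : (ℕ × ℕ) × List (ℕ × ℕ)) :
    0 < ((l.1 :: l.2).map fun p => p.2 + 1).sum := by
  simp

/-- Clearing denominators turns the integral estimate at an ideal measure into the inequality of
naturals that `smallLayerIntegral` decides. -/
theorem ENNReal.div_add_mul_lt_three_iff {a W M k : ℕ} (hW : 0 < W) :
    (a : ℝ≥0∞) / W + M * ENNReal.ofReal (1 / (k + 1)) < 3 ↔ a * (k + 1) + M * W < 3 * (W * (k + 1)) := by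
  have hW' : (0 : ℝ) < W := by exact_mod_cast hW
  have h : (a : ℝ≥0∞) / W + M * ENNReal.ofReal (1 / (k + 1)) =
      ENNReal.ofReal ((a : ℝ) / W + M * (1 / (k + 1))) := by
    rw [ENNReal.ofReal_add (by positivity) (by positivity), ENNReal.ofReal_div_of_pos hW',
      ENNReal.ofReal_mul (by positivity), ENNReal.ofReal_natCast, ENNReal.ofReal_natCast,
      ENNReal.ofReal_natCast]
  have h3 : (3 : ℝ≥0∞) = ENNReal.ofReal 3 := by simp
  rw [h, h3, ENNReal.ofReal_lt_ofReal_iff (by norm_num)]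
  have h4 : (a : ℝ) / W + M * (1 / (k + 1)) = (a * (k + 1) + M * W) / (W * (k + 1)) := by field_simp
  rw [h4, div_lt_iff₀ (by positivity)]
  exact_mod_cast Iff.rfl

variable [MeasurableSpace X] [BorelSpace X] {α : ℕ → X} {f : ℕ × ℕ × ℕ → ℕ}
  (e : ℕ → Option ((ℕ × ℕ × ℕ) × ℕ))

/-- Soundness of the certificate: passing from `P` to the ideal measure costs `1 / (k + 1)` in the
radii and `layerBound e n / (k + 1)` in the integral, and the test allows for both. -/
theorem lintegral_closedLayer_lt_three
    (hf : ∀ m n k : ℕ, |dist (α m) (α n) - (f (m, n, k) : ℝ) / 2 ^ k| ≤ 1 / 2 ^ k) {n k : ℕ}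
    {l : (ℕ × ℕ) × List (ℕ × ℕ)} (h : smallLayerIntegral f e n k l = true) {P : MeasSpace X}
    (hP : dist P (idealPoint α l) < 1 / (k + 1)) : ∫⁻ x, closedLayer α e n 0 x ∂P.meas < 3 := by
  have h1 := MeasSpace.lintegral_le_of_dist_lt hP (closedLayer_le_layerBound α e n 0)
    (measurableSet_lt_closedLayer α e n 0) (measurableSet_lt_closedLayer α e n (1 / (k + 1)))
    fun x y hxy => closedLayer_le α e le_rfl (by linarith)
  refine h1.trans_lt ?_
  change ∫⁻ x, _ ∂(idealMeas α l) + _ < _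
  rw [lintegral_natCast_idealMeas]
  refine lt_of_le_of_lt ?_
    ((ENNReal.div_add_mul_lt_three_iff (listWeight_pos l)).2 (of_decide_eq_true h))
  gcongr
  exact List.sum_map_mul_le fun j => closedLayer_le_approxLayer e hf n k j

/-- Completeness of the certificate: with fine enough precision, a nearby ideal measure passes the
test. -/
theorem exists_smallLayerIntegral (hα : DenseRange α)
    (hf : ∀ m n k : ℕ, |dist (α m) (α n) - (f (m, n, k) : ℝ) / 2 ^ k| ≤ 1 / 2 ^ k) {n : ℕ}
    {P : MeasSpace X} (h : ∫⁻ x, closedLayer α e n 0 x ∂P.meas < 3) :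
    ∃ k l, smallLayerIntegral f e n k l = true ∧ dist P (idealPoint α l) < 1 / (k + 1) := by
  -- The `4` is `3` for `approxLayer` plus `1` for moving from the ideal measure to `P`. The `2`
  -- counts the transport error and the equal margin inside the test.
  have ht : Filter.Tendsto (fun k : ℕ => ∫⁻ x, closedLayer α e n (4 / (k + 1)) x ∂P.meas +
      ENNReal.ofReal (2 * layerBound e n / (k + 1))) Filter.atTop
      (nhds (∫⁻ x, closedLayer α e n 0 x ∂P.meas + ENNReal.ofReal 0)) := by
    refine (tendsto_lintegral_closedLayer α e P.meas n (by norm_num)).add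
      ((ENNReal.continuous_ofReal.tendsto 0).comp ?_)
    exact tendsto_const_nhds.div_atTop
      (Filter.tendsto_atTop_add_const_right _ _ tendsto_natCast_atTop_atTop)
  rw [ENNReal.ofReal_zero, add_zero] at ht
  obtain ⟨k, hk⟩ := (ht.eventually (gt_mem_nhds h)).exists
  have hk0 : (0 : ℝ) < 1 / (k + 1) := by positivity
  obtain ⟨l, hl⟩ := exists_idealPoint_dist_lt hα P hk0
  refine ⟨k, l, decide_eq_true ?_, hl⟩
  rw [← ENNReal.div_add_mul_lt_three_iff (listWeight_pos l)]
  refine lt_of_le_of_lt ?_ hk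
  have h1 := MeasSpace.lintegral_le_of_dist_lt ((dist_comm _ _).trans_lt hl)
    (closedLayer_le_layerBound α e n (3 / (k + 1)))
    (measurableSet_lt_closedLayer α e n _) (measurableSet_lt_closedLayer α e n (4 / (k + 1)))
    fun x y hxy => closedLayer_le α e le_rfl (by
      have : (4 : ℝ) / (k + 1) = 3 / (k + 1) + 1 / (k + 1) := by ring
      linarith)
  change ∫⁻ x, _ ∂(idealMeas α l) ≤ _ at h1
  rw [lintegral_natCast_idealMeas] at h1
  have h2 : ENNReal.ofReal (2 * layerBound e n / (k + 1)) =
      layerBound e n * ENNReal.ofReal (1 / (k + 1)) +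
        layerBound e n * ENNReal.ofReal (1 / (k + 1)) := by
    rw [← ENNReal.ofReal_natCast, ← ENNReal.ofReal_mul (by positivity),
      ← ENNReal.ofReal_add (by positivity) (by positivity)]
    congr 1; ring
  rw [h2, ← add_assoc]
  gcongr
  refine le_trans ?_ h1
  gcongr
  exact List.sum_map_mul_le fun j => approxLayer_le_closedLayer e hf n k j

/-- The supremum of the functions `openLayer α e n` over those `n` for which the integral of
`closedLayer α e n 0` is less than `3`, divided by `3`. -/
noncomputable def trimmed (α : ℕ → X) (e : ℕ → Option ((ℕ × ℕ × ℕ) × ℕ)) (x : X)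
    (P : MeasSpace X) : ℝ≥0∞ :=
  ⨆ n : {n : ℕ // ∫⁻ x, closedLayer α e n 0 x ∂P.meas < 3}, (openLayer α e n x : ℝ≥0∞) / 3

/-- Closed layers increase with `n`, so the admitted ones form a chain; monotone convergence keeps
the bound `3`. -/
theorem lintegral_trimmed_le (P : MeasSpace X) : ∫⁻ x, trimmed α e x P ∂P.meas ≤ 1 := by
  have hle : ∀ x, trimmed α e x P ≤
      ⨆ n : {n : ℕ // ∫⁻ x, closedLayer α e n 0 x ∂P.meas < 3},
        (closedLayer α e n 0 x : ℝ≥0∞) / 3 := fun x =>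
    iSup_mono fun n => ENNReal.div_le_div_right
      (Nat.cast_le.2 (openLayer_le_closedLayer α e n x)) _
  have hm : ∀ n, Measurable fun x => (closedLayer α e n 0 x : ℝ≥0∞) := fun n =>
    (measurable_of_countable (fun k : ℕ => (k : ℝ≥0∞))).comp (measurable_closedLayer α e n 0)
  refine (lintegral_mono hle).trans ?_
  rw [lintegral_iSup_directed]
  · refine iSup_le fun n => ?_
    simp only [div_eq_mul_inv]
    rw [lintegral_mul_const _ (hm _), ← div_eq_mul_inv]
    exact ENNReal.div_le_of_le_mul (by simpa using n.2.le)
  · exact fun n => ((hm n).div_const 3).aemeasurable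
  · refine directed_of_isDirected_le fun n n' hn x => ?_
    exact ENNReal.div_le_div_right
      (Nat.cast_le.2 (closedLayer_le α e hn (by rw [dist_self, add_zero]))) _

end Trimming

/-! ### From class tests to uniform tests. -/

section Tests

theorem ratCode_nonneg (q : ℕ × ℕ) : 0 ≤ ratCode q := by unfold ratCode; positivity

theorem ratCode_lt_ratCode_iff {q q' : ℕ × ℕ} :
    ratCode q < ratCode q' ↔ q.1 * (q'.2 + 1) < q'.1 * (q.2 + 1) := by
  rw [ratCode, ratCode, div_lt_div_iff₀ (by positivity) (by positivity)]
  exact_mod_cast Iff.rfl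

theorem posRatCode_eq_ratCode (q : ℕ × ℕ) : posRatCode q = ratCode (q.1 + 1, q.2) := by
  simp [posRatCode, ratCode]

theorem exists_ratCode_btwn {q : ℕ × ℕ} {a : ℝ≥0∞} (h : ENNReal.ofReal (ratCode q) < a) :
    ∃ q', ratCode q < ratCode q' ∧ ENNReal.ofReal (ratCode q') < a := by
  obtain ⟨r, hr1, hr2⟩ := ENNReal.lt_iff_exists_nnreal_btwn.1 h
  have hr : ratCode q < r := by
    rw [← ENNReal.ofReal_coe_nnreal] at hr1
    exact (ENNReal.ofReal_lt_ofReal_iff_of_nonneg (ratCode_nonneg q)).1 hr1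
  obtain ⟨p, hp1, hp2⟩ := exists_posRatCode_btwn (ratCode_nonneg q) hr
  rw [posRatCode_eq_ratCode] at hp1 hp2
  refine ⟨_, hp1, lt_of_le_of_lt ?_ hr2⟩
  rw [← ENNReal.ofReal_coe_nnreal]
  exact ENNReal.ofReal_le_ofReal hp2.le

theorem ofReal_ratCode_lt_div_three_iff {q : ℕ × ℕ} {N : ℕ} :
    ENNReal.ofReal (ratCode q) < (N : ℝ≥0∞) / 3 ↔ 3 * q.1 < N * (q.2 + 1) := by
  have h : (N : ℝ≥0∞) / 3 = ENNReal.ofReal (N / 3 : ℝ) := by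
    rw [ENNReal.ofReal_div_of_pos (by norm_num)]; simp
  rw [h, ENNReal.ofReal_lt_ofReal_iff_of_nonneg (ratCode_nonneg q), ratCode,
    div_lt_div_iff₀ (by positivity) (by positivity), mul_comm]
  exact_mod_cast Iff.rfl

variable {X : Type*} [MetricSpace X] [MeasurableSpace X] [BorelSpace X]

theorem lowerSemicomputable_trimmed (S : ConstructiveMetricSpace X)
    {e : ℕ → Option ((ℕ × ℕ × ℕ) × ℕ)} (he : Computable e) :
    LowerSemicomputable (prodBase S.base S.measBase) (Function.uncurry (trimmed S.α e)) := by
  obtain ⟨f, hfc, hf⟩ := S.computable_dist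
  let I := ((ℕ × (ℕ × ℕ)) × (((ℕ × ℕ) × List (ℕ × ℕ)) × (ℕ × ℕ))) × (ℕ × ℕ)
  -- The witness is `z = (n, m, k, v)`: layer `n`, an entry `m < n` with value `v`, precision `k`.
  -- The product's first ball is that entry's ball; its second has radius code `(0, k)`, that is `1
  -- / (k + 1)`.
  let c : I → ℕ × ℕ × ℕ × ℕ → Bool := fun p z =>
    decide (z.2.1 < z.1) && (decide (e z.2.1 = some (p.1.1, z.2.2.2)) &&
      (decide (3 * p.2.1 < (z.2.2.2 + 1) * (p.2.2 + 1)) && (decide (p.1.2.2 = (0, z.2.2.1)) &&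
        smallLayerIntegral f e z.1 z.2.2.1 p.1.2.1)))
  have hc : Computable₂ c := by
    have hq : Computable fun w : I × (ℕ × ℕ × ℕ × ℕ) => w.1.2 := Computable.snd.comp .fst
    have hi : Computable fun w : I × (ℕ × ℕ × ℕ × ℕ) => w.1.1 := Computable.fst.comp .fst
    have hn : Computable fun w : I × (ℕ × ℕ × ℕ × ℕ) => w.2.1 := Computable.fst.comp .snd
    have h2 : Computable fun w : I × (ℕ × ℕ × ℕ × ℕ) => w.2.2 := Computable.snd.comp .snd
    have hm : Computable fun w : I × (ℕ × ℕ × ℕ × ℕ) => w.2.2.1 := Computable.fst.comp h2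
    have h3 : Computable fun w : I × (ℕ × ℕ × ℕ × ℕ) => w.2.2.2 := Computable.snd.comp h2
    have hk : Computable fun w : I × (ℕ × ℕ × ℕ × ℕ) => w.2.2.2.1 := Computable.fst.comp h3
    have hv : Computable fun w : I × (ℕ × ℕ × ℕ × ℕ) => w.2.2.2.2 := Computable.snd.comp h3
    have h1 : Computable fun w : I × (ℕ × ℕ × ℕ × ℕ) => w.1.1.1 := Computable.fst.comp hi
    have hQr : Computable fun w : I × (ℕ × ℕ × ℕ × ℕ) => w.1.1.2 := Computable.snd.comp hi
    have hQ : Computable fun w : I × (ℕ × ℕ × ℕ × ℕ) => w.1.1.2.1 := Computable.fst.comp hQr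
    have hr : Computable fun w : I × (ℕ × ℕ × ℕ × ℕ) => w.1.1.2.2 := Computable.snd.comp hQr
    have d1 := Computable.nat_lt_dec hm hn
    have d2 := Computable.eq_dec (he.comp hm) (Computable.option_some.comp (h1.pair hv))
    have d3 := Computable.nat_lt_dec ((Computable.const 3).mul' (Computable.fst.comp hq))
      ((Computable.succ.comp hv).mul' (Computable.succ.comp (Computable.snd.comp hq)))
    have d4 := Computable.eq_dec hr ((Computable.const 0).pair hk)
    have d5 := computable_smallLayerIntegral hfc he hn hk hQ
    exact d1.bool_and (d2.bool_and (d3.bool_and (d4.bool_and d5)))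
  have hball : ∀ k : ℕ, posRatCode (0, k) = 1 / ((k : ℝ) + 1) := fun k => by simp [posRatCode]
  refine ⟨fun p => ∃ z, c p z = true, REPred.exists_decide hc, fun q => ?_⟩
  ext ⟨x, P⟩
  simp only [mem_ofPred_eq, Function.uncurry_apply_pair, mem_iUnion, exists_prop, trimmed,
    lt_iSup_iff, ofReal_ratCode_lt_div_three_iff, c, Bool.and_eq_true, decide_eq_true_eq]
  constructor
  · rintro ⟨⟨n, hn⟩, h⟩
    have hpos : 0 < openLayer S.α e n x := Nat.pos_of_ne_zero fun h0 => by simp [h0] at h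
    obtain ⟨m, hm, b, hb, hx, hv⟩ :=
      (lt_openLayer_iff S.α e (s := openLayer S.α e n x - 1)).1 (Nat.sub_lt hpos one_pos)
    obtain ⟨k, l, hs, hl⟩ := exists_smallLayerIntegral e S.dense hf hn
    refine ⟨(b.1, (l, (0, k))), ⟨(n, m, k, b.2), hm, hb, ?_, rfl, hs⟩, hx, ?_⟩
    · exact h.trans_le (Nat.mul_le_mul_right _ (by simp only; omega))
    · change dist P (idealPoint S.α l) < posRatCode (0, k)
      rwa [hball]
  · rintro ⟨⟨i, l, r⟩, ⟨⟨n, m, k, v⟩, hm, hb, hq, hr, hs⟩, hx, hP⟩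
    simp only at hm hb hq hr hs
    subst hr
    change dist P (idealPoint S.α l) < posRatCode (0, k) at hP
    rw [hball] at hP
    refine ⟨⟨n, lintegral_closedLayer_lt_three e hf hs hP⟩, hq.trans_le (Nat.mul_le_mul_right _ ?_)⟩
    exact (lt_openLayer_iff S.α e).2 ⟨m, hm, (i, v), hb, hx, Nat.lt_succ_self v⟩

/-- Every test for a class is dominated on that class by a uniform test. -/
theorem ConstructiveMetricSpace.IsClassTest.exists_isUniformTest {S : ConstructiveMetricSpace X}
    {C : Set (MeasSpace X)} {t : X → ℝ≥0∞} (ht : S.IsClassTest C t) :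
    ∃ u, S.IsUniformTest u ∧ ∀ P ∈ C, ∀ x, t x ≤ 3 * u x P := by
  obtain ⟨⟨E, hE, hEt⟩, hint⟩ := ht
  -- A ball is enumerated with value `v` when a strictly larger concentric ball is listed for `t >
  -- v`. Then `t > v` also on the closed ball, which is what bounds the closed layers.
  have hR : REPred fun p : (ℕ × ℕ × ℕ) × ℕ => ∃ r : ℕ × ℕ,
      decide ((p.1.2.1 + 1) * (r.2 + 1) < (r.1 + 1) * (p.1.2.2 + 1)) = true ∧
        E ((p.1.1, r), (p.2, 0)) := by
    have h1 : Computable fun w : ((ℕ × ℕ × ℕ) × ℕ) × (ℕ × ℕ) => w.1.1 := Computable.fst.comp .fst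
    have h2 : Computable fun w : ((ℕ × ℕ × ℕ) × ℕ) × (ℕ × ℕ) => w.1.1.2 := Computable.snd.comp h1
    have d : Computable₂ fun (p : (ℕ × ℕ × ℕ) × ℕ) (r : ℕ × ℕ) =>
        decide ((p.1.2.1 + 1) * (r.2 + 1) < (r.1 + 1) * (p.1.2.2 + 1)) :=
      Computable.nat_lt_dec ((Computable.succ.comp (Computable.fst.comp h2)).mul'
          (Computable.succ.comp (Computable.snd.comp .snd)))
        ((Computable.succ.comp (Computable.fst.comp .snd)).mul'
          (Computable.succ.comp (Computable.snd.comp h2)))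
    exact REPred.exists_and d hE (h := fun p r => ((p.1.1, r), (p.2, 0)))
      (((Computable.fst.comp h1).pair .snd).pair ((Computable.snd.comp .fst).pair (.const 0)))
  obtain ⟨e, he, hRe⟩ := hR.exists_enum
  have hlt : ∀ q r : ℕ × ℕ, decide ((q.1 + 1) * (r.2 + 1) < (r.1 + 1) * (q.2 + 1)) = true ↔
      posRatCode q < posRatCode r := fun q r => by
    rw [posRatCode_eq_ratCode, posRatCode_eq_ratCode, ratCode_lt_ratCode_iff, decide_eq_true_iff]
  have hval : ∀ v : ℕ, ENNReal.ofReal (ratCode (v, 0)) = v := fun v => by simp [ratCode]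
  have hclosed : ∀ n x, (closedLayer S.α e n 0 x : ℝ≥0∞) ≤ t x + 1 := by
    intro n x
    rcases Nat.eq_zero_or_pos (closedLayer S.α e n 0 x) with h0 | hpos
    · simp [h0]
    obtain ⟨m, -, b, hb, hx, hv⟩ :=
      (lt_closedLayer_iff S.α e (s := closedLayer S.α e n 0 x - 1)).1 (Nat.sub_lt hpos one_pos)
    obtain ⟨r, hr, hEr⟩ := (hRe b).2 ⟨m, hb⟩
    have hx' : x ∈ {x | ENNReal.ofReal (ratCode (b.2, 0)) < t x} := by
      rw [hEt]
      refine mem_biUnion (x := (b.1.1, r)) hEr ?_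
      have := (hlt _ _).1 hr
      exact Metric.mem_ball.2 (by simp only; linarith)
    rw [mem_ofPred_eq, hval] at hx'
    calc (closedLayer S.α e n 0 x : ℝ≥0∞) ≤ ((b.2 + 1 : ℕ) : ℝ≥0∞) := Nat.cast_le.2 (by omega)
      _ = b.2 + 1 := by push_cast; rfl
      _ ≤ t x + 1 := by gcongr
  -- Shrinking the balls loses no point: an open ball is the union of its smaller concentric ones of
  -- rational radius.
  have hopen : ∀ x (a : ℝ≥0∞), a < t x → ∃ n, a ≤ openLayer S.α e n x := by
    intro x a ha
    lift a to ℝ≥0 using ha.ne_top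
    have hx : x ∈ {x | ENNReal.ofReal (ratCode (⌊a⌋₊, 0)) < t x} := by
      rw [mem_ofPred_eq, hval]
      refine lt_of_le_of_lt ?_ ha
      exact_mod_cast Nat.floor_le a.2
    rw [hEt] at hx
    simp only [mem_iUnion, exists_prop] at hx
    obtain ⟨⟨i, r⟩, hEr, hxr⟩ := hx
    obtain ⟨q, hq1, hq2⟩ := exists_posRatCode_btwn dist_nonneg (Metric.mem_ball.1 hxr)
    obtain ⟨m, hm⟩ := (hRe ((i, q), ⌊a⌋₊)).1 ⟨r, (hlt _ _).2 hq2, hEr⟩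
    refine ⟨m + 1, ?_⟩
    have h1 : ⌊a⌋₊ < openLayer S.α e (m + 1) x :=
      (lt_openLayer_iff S.α e).2 ⟨m, Nat.lt_succ_self m, _, hm, hq1, Nat.lt_succ_self _⟩
    have h2 : a ≤ (openLayer S.α e (m + 1) x : ℝ≥0) :=
      (Nat.lt_floor_add_one a).le.trans (by exact_mod_cast h1)
    exact_mod_cast h2
  refine ⟨trimmed S.α e, ⟨lowerSemicomputable_trimmed S he, lintegral_trimmed_le e⟩,
    fun P hP x => le_of_forall_lt fun a ha => ?_⟩
  -- On `C` every layer is admitted: its integral is at most `∫ t + 1 ≤ 2`, strictly below the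
  -- threshold `3`.
  have hn : ∀ n, ∫⁻ x, closedLayer S.α e n 0 x ∂P.meas < 3 := fun n => by
    refine (lintegral_mono (hclosed n)).trans_lt ?_
    rw [lintegral_add_right _ measurable_const, lintegral_const, measure_univ, one_mul]
    calc _ ≤ (1 : ℝ≥0∞) + 1 := by gcongr; exact hint P hP
      _ < 3 := by norm_num
  obtain ⟨b, hab, hb⟩ := exists_between ha
  obtain ⟨n, hbn⟩ := hopen x b hb
  refine hab.trans_le (hbn.trans ?_)
  have : (openLayer S.α e n x : ℝ≥0∞) / 3 ≤ trimmed S.α e x P :=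
    le_iSup (fun n : {n : ℕ // ∫⁻ x, closedLayer S.α e n 0 x ∂P.meas < 3} =>
      (openLayer S.α e n x : ℝ≥0∞) / 3) ⟨n, hn n⟩
  rw [mul_comm]
  exact (ENNReal.div_le_iff (by norm_num) (by norm_num)).1 this

end Tests

/-! ### Decidable inclusion of basic balls. -/

section FormalInclusion

variable {X : Type*} [MetricSpace X]

/-- A decidable sufficient condition for the ball named by `j` to be contained in the ball named
by `i`. -/
def formallyIncluded (f : ℕ × ℕ × ℕ → ℕ) (k : ℕ) (j i : ℕ × ℕ × ℕ) : Bool :=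
  decide ((f (j.1, i.1, k) + 1) * ((j.2.2 + 1) * (i.2.2 + 1)) +
    2 ^ k * ((j.2.1 + 1) * (i.2.2 + 1)) ≤ 2 ^ k * ((i.2.1 + 1) * (j.2.2 + 1)))

theorem formallyIncluded_iff {f : ℕ × ℕ × ℕ → ℕ} {k : ℕ} {j i : ℕ × ℕ × ℕ} :
    formallyIncluded f k j i = true ↔
      (f (j.1, i.1, k) : ℝ) / 2 ^ k + 1 / 2 ^ k + posRatCode j.2 ≤ posRatCode i.2 := by
  have h : (f (j.1, i.1, k) : ℝ) / 2 ^ k + 1 / 2 ^ k + posRatCode j.2 =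
      ((f (j.1, i.1, k) + 1) * ((j.2.2 + 1) * (i.2.2 + 1)) + 2 ^ k * ((j.2.1 + 1) * (i.2.2 + 1))) /
        (2 ^ k * ((i.2.2 + 1) * (j.2.2 + 1))) := by
    unfold posRatCode; field_simp
  have h' : posRatCode i.2 =
      (2 ^ k * ((i.2.1 + 1) * (j.2.2 + 1))) / (2 ^ k * ((i.2.2 + 1) * (j.2.2 + 1))) := by
    unfold posRatCode; field_simp
  rw [h, h', div_le_div_iff_of_pos_right (by positivity), formallyIncluded, decide_eq_true_iff]
  exact_mod_cast Iff.rfl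

theorem computable_formallyIncluded {f : ℕ × ℕ × ℕ → ℕ} (hf : Computable f) {A : Type*}
    [Primcodable A] {k : A → ℕ} {j i : A → ℕ × ℕ × ℕ} (hk : Computable k) (hj : Computable j)
    (hi : Computable i) : Computable fun a => formallyIncluded f (k a) (j a) (i a) := by
  have ia := Computable.succ.comp (Computable.fst.comp (Computable.snd.comp hi))
  have ib := Computable.succ.comp (Computable.snd.comp (Computable.snd.comp hi))
  have ja := Computable.succ.comp (Computable.fst.comp (Computable.snd.comp hj))
  have jb := Computable.succ.comp (Computable.snd.comp (Computable.snd.comp hj))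
  have hp := Computable.nat_pow.comp (.const 2) hk
  have hF := Computable.succ.comp
    (hf.comp ((Computable.fst.comp hj).pair ((Computable.fst.comp hi).pair hk)))
  exact Computable.nat_le_dec ((hF.mul' (jb.mul' ib)).add' (hp.mul' (ja.mul' ib)))
    (hp.mul' (ia.mul' jb))

theorem basicBall_subset_of_formallyIncluded {α : ℕ → X} {f : ℕ × ℕ × ℕ → ℕ}
    (hf : ∀ m n k : ℕ, |dist (α m) (α n) - (f (m, n, k) : ℝ) / 2 ^ k| ≤ 1 / 2 ^ k) {k : ℕ}
    {j i : ℕ × ℕ × ℕ} (h : formallyIncluded f k j i = true) : basicBall α j ⊆ basicBall α i := by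
  refine Metric.ball_subset_ball' ?_
  have h1 := formallyIncluded_iff.1 h
  have h2 := abs_le.1 (hf j.1 i.1 k)
  linarith

theorem exists_formallyIncluded {α : ℕ → X} {f : ℕ × ℕ × ℕ → ℕ}
    (hf : ∀ m n k : ℕ, |dist (α m) (α n) - (f (m, n, k) : ℝ) / 2 ^ k| ≤ 1 / 2 ^ k)
    {j i : ℕ × ℕ × ℕ} (h : dist (α j.1) (α i.1) + posRatCode j.2 < posRatCode i.2) :
    ∃ k, formallyIncluded f k j i = true := by
  -- Half the gap, because the error `1 / 2 ^ k` enters twice: in the approximate distance and in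
  -- the test.
  obtain ⟨k, hk⟩ := exists_pow_lt_of_lt_one
    (show 0 < (posRatCode i.2 - (dist (α j.1) (α i.1) + posRatCode j.2)) / 2 by linarith)
    (show (1 / 2 : ℝ) < 1 by norm_num)
  rw [one_div_pow] at hk
  refine ⟨k, formallyIncluded_iff.2 ?_⟩
  have h2 := abs_le.1 (hf j.1 i.1 k)
  linarith

/-- Finitely many basic balls with a common point contain, formally, a basic ball around it. -/
theorem exists_basicBall_formallyIncluded {α : ℕ → X} (hα : DenseRange α) {f : ℕ × ℕ × ℕ → ℕ}
    (hf : ∀ m n k : ℕ, |dist (α m) (α n) - (f (m, n, k) : ℝ) / 2 ^ k| ≤ 1 / 2 ^ k) {x : X}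
    {s : Set (ℕ × ℕ × ℕ)} (hs : s.Finite) (hx : ∀ i ∈ s, x ∈ basicBall α i) :
    ∃ j, x ∈ basicBall α j ∧ ∀ i ∈ s, ∃ k, formallyIncluded f k j i = true := by
  obtain ⟨ε, hε, h⟩ : ∃ ε > 0, ∀ i ∈ s, dist x (α i.1) + ε ≤ posRatCode i.2 := by
    have : ∀ᶠ ε : ℝ in nhdsWithin 0 (Ioi 0), ∀ i ∈ s, dist x (α i.1) + ε ≤ posRatCode i.2 := by
      rw [Filter.eventually_all_finite hs]
      intro i hi
      have h1 : 0 < posRatCode i.2 - dist x (α i.1) := sub_pos.2 (Metric.mem_ball.1 (hx i hi))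
      filter_upwards [Ioo_mem_nhdsGT h1] with ε hε
      linarith [hε.2]
    obtain ⟨ε, h1, h2⟩ := (this.and self_mem_nhdsWithin).exists
    exact ⟨ε, h2, h1⟩
  -- The radius is counted twice, for the distance from `x` to the new centre and for the ball
  -- itself, hence `ε / 2`.
  obtain ⟨r, -, hr⟩ := exists_posRatCode_btwn le_rfl (half_pos hε)
  obtain ⟨m, hm⟩ := hα.exists_dist_lt x (posRatCode_pos r)
  refine ⟨(m, r), hm, fun i hi => exists_formallyIncluded hf ?_⟩
  have h1 := h i hi
  have h2 := dist_triangle (α m) x (α i.1)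
  rw [dist_comm] at hm
  simp only
  linarith

end FormalInclusion

/-! ### Infimum over an effectively compact class, and the theorem. -/

section InfimumTest

variable {X : Type*} [MetricSpace X]

/-- The infimum of a lower semicomputable function over an effectively compact set of parameters
is lower semicomputable. -/
theorem LowerSemicomputable.iInf_of_effectivelyCompact {Y κ : Type*} [TopologicalSpace Y]
    [Primcodable κ] {α : ℕ → X} (hα : DenseRange α) {f : ℕ × ℕ × ℕ → ℕ} (hfc : Computable f)
    (hf : ∀ m n k : ℕ, |dist (α m) (α n) - (f (m, n, k) : ℝ) / 2 ^ k| ≤ 1 / 2 ^ k)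
    {b : κ → Set Y} (hb : ∀ i, IsOpen (b i)) {C : Set Y} (hC : EffectivelyCompact b C)
    {t : X → Y → ℝ≥0∞}
    (ht : LowerSemicomputable (prodBase (basicBall α) b) (Function.uncurry t)) :
    LowerSemicomputable (basicBall α) fun x => ⨅ P ∈ C, t x P := by
  obtain ⟨hCc, hcov⟩ := hC
  obtain ⟨E, hE, hEt⟩ := ht
  obtain ⟨g, hg, hEg⟩ := hE.exists_stage
  let I := (ℕ × ℕ × ℕ) × (ℕ × ℕ)
  let J := ((ℕ × ℕ × ℕ) × κ) × (ℕ × ℕ)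
  -- A witness is a rational `q' > q` and a finite list of products listed for `t > q'`, each with a
  -- stage and a precision. Their first factors must formally contain the given ball, and their
  -- second factors must cover `C`.
  let test : I × ((ℕ × ℕ) × List J) → J → Bool := fun w a =>
    g (a.1, w.2.1) a.2.1 && formallyIncluded f a.2.2 w.1.1 a.1.1
  let c : I → (ℕ × ℕ) × List J → Bool := fun p z =>
    decide (p.2.1 * (z.1.2 + 1) < z.1.1 * (p.2.2 + 1)) && z.2.all (test (p, z))
  have htest : Computable₂ test := by
    have hp : Computable fun w : (I × ((ℕ × ℕ) × List J)) × J => w.1.1.1 :=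
      Computable.fst.comp (Computable.fst.comp .fst)
    have hq : Computable fun w : (I × ((ℕ × ℕ) × List J)) × J => w.1.2.1 :=
      Computable.fst.comp (Computable.snd.comp .fst)
    have h1 : Computable fun w : (I × ((ℕ × ℕ) × List J)) × J => w.2.1 := Computable.fst.comp .snd
    have h2 : Computable fun w : (I × ((ℕ × ℕ) × List J)) × J => w.2.2 := Computable.snd.comp .snd
    exact (hg.comp (h1.pair hq) (Computable.fst.comp h2)).bool_and
      (computable_formallyIncluded hfc (Computable.snd.comp h2) hp (Computable.fst.comp h1))
  have hc : Computable₂ c := by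
    have hq : Computable fun w : I × ((ℕ × ℕ) × List J) => w.1.2 := Computable.snd.comp .fst
    have hq' : Computable fun w : I × ((ℕ × ℕ) × List J) => w.2.1 := Computable.fst.comp .snd
    have hL : Computable fun w : I × ((ℕ × ℕ) × List J) => w.2.2 := Computable.snd.comp .snd
    exact (Computable.nat_lt_dec
      ((Computable.fst.comp hq).mul' (Computable.succ.comp (Computable.snd.comp hq')))
      ((Computable.fst.comp hq').mul' (Computable.succ.comp (Computable.snd.comp hq)))).bool_and
      (Computable.list_all hL htest)
  have hmap : Computable₂ fun (_ : I) (z : (ℕ × ℕ) × List J) => z.2.map fun a => a.1.2 := by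
    have h1 : Primrec fun w : I × ((ℕ × ℕ) × List J) => w.2.2 := Primrec.snd.comp .snd
    have h2 : Primrec₂ fun (_ : I × ((ℕ × ℕ) × List J)) (a : J) => a.1.2 :=
      Primrec.snd.comp (Primrec.fst.comp .snd)
    exact (Primrec.list_map h1 h2).to_comp
  refine ⟨_, REPred.exists_and hc hcov hmap, fun q => ?_⟩
  ext x
  simp only [mem_ofPred_eq, mem_iUnion, exists_prop]
  constructor
  · intro hx
    -- A cover yields only `t > q'` pointwise, so the infimum is at least `q'`; the gap `q < q'`
    -- restores strictness.
    obtain ⟨q', hqq', hq'⟩ := exists_ratCode_btwn hx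
    have hcover : C ⊆ ⋃ i ∈ {i : (ℕ × ℕ × ℕ) × κ | E (i, q') ∧ x ∈ basicBall α i.1}, b i.2 := by
      intro P hP
      have h : (x, P) ∈ {z | ENNReal.ofReal (ratCode q') < Function.uncurry t z} :=
        hq'.trans_le (iInf₂_le P hP)
      rw [hEt] at h
      simp only [mem_iUnion, exists_prop] at h
      obtain ⟨i, hi, hxi, hPi⟩ := h
      exact mem_biUnion (x := i) ⟨hi, hxi⟩ hPi
    obtain ⟨s, hsub, hsfin, hscov⟩ := hCc.elim_finite_subcover_image (fun i _ => hb i.2) hcover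
    obtain ⟨j, hxj, hj⟩ := exists_basicBall_formallyIncluded hα hf (hsfin.image Prod.fst)
      (x := x) (by rintro _ ⟨i, hi, rfl⟩; exact (hsub hi).2)
    have hw : ∀ i ∈ s, ∃ nk : ℕ × ℕ, g (i, q') nk.1 = true ∧
        formallyIncluded f nk.2 j i.1 = true := by
      intro i hi
      obtain ⟨n, hn⟩ := (hEg _).1 (hsub hi).1
      obtain ⟨k, hk⟩ := hj i.1 (mem_image_of_mem _ hi)
      exact ⟨(n, k), hn, hk⟩
    choose! nk hnk using hw
    refine ⟨j, ⟨(q', hsfin.toFinset.toList.map fun i => (i, nk i)), ?_, ?_⟩, hxj⟩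
    · simp only [c, test, Bool.and_eq_true, decide_eq_true_eq, List.all_eq_true, List.mem_map,
        Finset.mem_toList, Finite.mem_toFinset]
      refine ⟨ratCode_lt_ratCode_iff.1 hqq', ?_⟩
      rintro _ ⟨i, hi, rfl⟩
      exact hnk i hi
    · intro P hP
      obtain ⟨i, hi, hPi⟩ := mem_iUnion₂.1 (hscov hP)
      refine mem_biUnion (x := i.2) ?_ hPi
      exact List.mem_map.2 ⟨(i, nk i), List.mem_map.2 ⟨i, by simpa using hi, rfl⟩, rfl⟩
  · rintro ⟨j, ⟨⟨q', L⟩, hcL, hL⟩, hxj⟩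
    simp only [c, test, Bool.and_eq_true, decide_eq_true_eq, List.all_eq_true] at hcL
    have hqq' : ratCode q < ratCode q' := ratCode_lt_ratCode_iff.2 hcL.1
    refine lt_of_lt_of_le ((ENNReal.ofReal_lt_ofReal_iff_of_nonneg (ratCode_nonneg q)).2 hqq')
      (le_iInf₂ fun P hP => ?_)
    obtain ⟨i, hi, hPi⟩ := mem_iUnion₂.1 (hL hP)
    obtain ⟨a, ha, rfl⟩ := List.mem_map.1 hi
    obtain ⟨h1, h2⟩ := hcL.2 a ha
    have h : (x, P) ∈ {z | ENNReal.ofReal (ratCode q') < Function.uncurry t z} := by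
      rw [hEt]
      exact mem_biUnion (x := a.1) ((hEg _).2 ⟨_, h1⟩)
        ⟨basicBall_subset_of_formallyIncluded hf h2 hxj, hPi⟩
    exact le_of_lt h

end InfimumTest

/-- The infimum lies below `t x P` for each `P ∈ C`, which bounds its integral; compactness serves
lower semicomputability. -/
theorem ConstructiveMetricSpace.IsUniformTest.isClassTest_iInf {X : Type*} [MetricSpace X]
    [MeasurableSpace X] [BorelSpace X] {S : ConstructiveMetricSpace X} {C : Set (MeasSpace X)}
    (hC : EffectivelyCompact S.measBase C) {t : X → MeasSpace X → ℝ≥0∞} (ht : S.IsUniformTest t) :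
    S.IsClassTest C fun x => ⨅ P ∈ C, t x P := by
  obtain ⟨f, hfc, hf⟩ := S.computable_dist
  exact ⟨LowerSemicomputable.iInf_of_effectivelyCompact S.dense hfc hf
    (fun _ => Metric.isOpen_ball) hC ht.1,
    fun P hP => (lintegral_mono fun x => iInf₂_le P hP).trans (ht.2 P)⟩

theorem mainTheorem12 {X : Type*} [MetricSpace X] [MeasurableSpace X] [BorelSpace X]
    (S : ConstructiveMetricSpace X)
    (C : Set (MeasSpace X))
    (hC : EffectivelyCompact S.measBase C)
    (hC_orth : S.EffectivelyOrthogonal C)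
    (t : X → MeasSpace X → ℝ≥0∞) (ht : S.IsUniversalUniformTest t)
    (tC : X → ℝ≥0∞) (htC : S.IsUniversalClassTest C tC)
    (s : X → MeasSpace X → ℝ≥0∞) (hs : S.IsTestSeparator C s) :
    ∃ c : ℝ≥0, ∀ P ∈ C, ∀ x : X,
      t x P ≤ c * max (tC x) (s x P) ∧ max (tC x) (s x P) ≤ c * t x P := by
  obtain ⟨c₁, hc₁⟩ := ht.2 s ⟨hs.2, hs.1.lintegral_le⟩
  obtain ⟨u, hu, htCu⟩ := htC.1.exists_isUniformTest
  obtain ⟨c₂, hc₂⟩ := ht.2 u hu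
  obtain ⟨c₃, hc₃⟩ := htC.2 _ (ht.1.isClassTest_iInf hC)
  -- The constant is at least `1`, so that an infinite value of `s` gives an infinite bound.
  refine ⟨1 + c₁ + 3 * c₂ + c₃, fun P hP x => ⟨?_, max_le ?_ ?_⟩⟩
  · by_cases hsP : s x P = ∞
    · rw [hsP, max_eq_right le_top, ENNReal.mul_top (by
        exact_mod_cast (by positivity : (0 : ℝ≥0) < 1 + c₁ + 3 * c₂ + c₃).ne')]
      exact le_top
    -- With `s x P` finite, every other `Q ∈ C` has `t x Q = ∞`, so the infimum is attained at `P`.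
    have hinf : ∀ Q ∈ C, t x P ≤ t x Q := by
      intro Q hQ
      rcases eq_or_ne P Q with rfl | hne
      · exact le_rfl
      have hsQ : s x Q = ∞ := (hs.1.separates P hP Q hQ hne x).resolve_left hsP
      have h := hc₁ x Q
      rw [hsQ, top_le_iff] at h
      have htQ : t x Q = ∞ := by
        by_contra hfin
        exact ENNReal.mul_ne_top ENNReal.coe_ne_top hfin h
      rw [htQ]
      exact le_top
    calc t x P ≤ ⨅ Q ∈ C, t x Q := le_iInf₂ hinf
      _ ≤ c₃ * tC x := hc₃ x
      _ ≤ _ := by gcongr; exacts [le_add_self, le_max_left _ _]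
  · calc tC x ≤ 3 * u x P := htCu P hP x
      _ ≤ 3 * (c₂ * t x P) := by gcongr; exact hc₂ x P
      _ = ((3 * c₂ : ℝ≥0) : ℝ≥0∞) * t x P := by push_cast; rw [mul_assoc]
      _ ≤ _ := by gcongr; exact le_trans le_add_self le_self_add
  · calc s x P ≤ c₁ * t x P := hc₁ x P
      _ ≤ _ := by
        gcongr
        exact le_trans (le_trans le_add_self le_self_add) le_self_add
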